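/- Let $A_0,A_1,\dots$ be complex $m\times n$ matrices. The Toeplitz rank search on $(A_k)_{k\ge 0}$ sets $\rho_{-1}=0$, $P^{(-1)}_k=A_k$, and performs the steps $i=0,1,2,\dots$ as follows. Write $P^{(i-1)}_0=[L\;\,R]$, where $L$ has $\rho_{i-1}$ columns, put $Z_i=-L^\dagger R$ (Moore–Penrose inverse), choose a unitary $Q_i$ such that $(I-LL^\dagger)RQ_i=[L_+\;\,0]$ with $L_+$ of full column rank, let $e_i$ be the number of columns of $L_+$, $\rho_i=\rho_{i-1}+e_i$, $\nu_i=n-\rho_i$, and $$N_i=\begin{bmatrix} I&Z_i\\0&I\end{bmatrix}\begin{bmatrix} I&0\\0&Q_i\end{bmatrix}.$$ Then $P^{(i-1)}_0N_i=[L_0^{(i)}\;\,0]$, where $L_0^{(i)}=[L\;\,L_+]$ has $\rho_i$ columns; finally, the first $\rho_i$ columns of $P^{(i)}_k$ are those of $P^{(i-1)}_kN_i$, and the last $\nu_i$ columns of $P^{(i)}_k$ are those of $P^{(i-1)}_{k+1}N_i$. For $\lambda_0\in\mathbb C$ put $\Lambda_i(\lambda)=\operatorname{diag}(I_{\rho_i},(\lambda-\lambda_0)I_{\nu_i})$.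 The structural indices at $\lambda_0$ of a rational $m\times n$ matrix $R(\lambda)$ of normal rank $r$ are the integers $\sigma_1\le\dots\le\sigma_r$ such that $M(\lambda)R(\lambda)N(\lambda)$ has upper left block $\operatorname{diag}((\lambda-\lambda_0)^{\sigma_1},\dots,(\lambda-\lambda_0)^{\sigma_r})$ and zeros elsewhere, for some square rational matrices $M,N$ without pole at $\lambda_0$ and with $M(\lambda_0),N(\lambda_0)$ invertible. **Theorem.** (0) The search can be carried out on every sequence $(A_k)$, and for every choice of the $Q_i$ and every $k\ge0$ the block upper triangular Toeplitz matrix $T_k$ with first block row $A_0,\dots,A_k$ has rank $\rho_0+\dots+\rho_k$. (1) Let $P(\lambda)$ be an $m\times n$ complex polynomial matrix of normal rank $r$, and run the search on the coefficients of its expansion in powers of $\lambda-\lambda_0$, with any admissible choices. Then some $\rho_k$ equals $r$; let $d'$ be the smallest such $k\geq 0$. The matrix $$N(\lambda):=N_0\Lambda_0^{-1}N_1\Lambda_1^{-1}\cdots N_{d'}\Lambda_{d'}^{-1}\,\Lambda_0\Lambda_1\cdots\Lambda_{d'}$$ is polynomial and unimodular, $P^{(d')}(\lambda)=\sum_kP^{(d')}_k(\lambda-\lambda_0)^k$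 is a polynomial matrix, and $$P(\lambda)N(\lambda)=P^{(d')}(\lambda)\,\Lambda(\lambda),$$ $$\Lambda(\lambda)=\Lambda_0\cdots\Lambda_{d'}=\operatorname{diag}\bigl(I_{e_0},(\lambda-\lambda_0)I_{e_1},\dots,(\lambda-\lambda_0)^{d'}I_{e_{d'}},(\lambda-\lambda_0)^{d'+1}I_{\nu_{d'}}\bigr),$$ where $P^{(d')}(\lambda_0)$ has rank $r$ and its first $r$ columns form $L_0^{(d')}$. Equivalently, with the factor $\Lambda_{d'}$ kept on the left and $\widetilde P(\lambda):=P^{(d')}(\lambda)\Lambda_{d'}(\lambda)$, $$P(\lambda)N(\lambda)=\widetilde P(\lambda)\,\widetilde\Lambda(\lambda),$$ $$\widetilde\Lambda(\lambda)=\Lambda_0\cdots\Lambda_{d'-1}=\operatorname{diag}\bigl(I_{e_0},(\lambda-\lambda_0)I_{e_1},\dots,(\lambda-\lambda_0)^{d'-1}I_{e_{d'-1}},(\lambda-\lambda_0)^{d'}I_{\nu_{d'-1}}\bigr),$$ and $\widetilde P(\lambda_0)=[L_0^{(d')}\;\,0]$ has rank $r$ and nullity $n-r$. Discarding the last $n-r$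 columns gives a compact local Smith form of $P$ at $\lambda_0$: if $N_r$ and $\hat M_r$ consist of the first $r$ columns of $N$ and $P^{(d')}$, then $$P(\lambda)N_r(\lambda)=\hat M_r(\lambda)\operatorname{diag}\bigl(I_{e_0},(\lambda-\lambda_0)I_{e_1},\dots,(\lambda-\lambda_0)^{d'}I_{e_{d'}}\bigr),$$ the exponents on the diagonal are the structural indices of $P$ at $\lambda_0$, $N_r$ has a polynomial left inverse, and $\hat M_r(\lambda_0)$ has a left inverse. (2) Let $R(\lambda)=\sum_{k\ge-\ell}R_k(\lambda-\lambda_0)^k$ be an $m\times n$ complex rational matrix of normal rank $r$ with at most a pole of order $\ell\ge0$ at $\lambda_0$, and run the search on $R_{-\ell},R_{-\ell+1},\dots$. Then the assertions of (1) on $d'$, on $N(\lambda)$ and on the two factorizations hold with $P$ replaced by $(\lambda-\lambda_0)^{\ell}R$ and with a rational matrix $R^{(d')}(\lambda)$ without pole at $\lambda_0$, whose Taylor coefficients at $\lambda_0$ are the $P^{(d')}_k$, in place of $P^{(d')}(\lambda)$. The first $r$ columns $N_r$ of $N$ and $\hat M_r$ of $R^{(d')}$ give a compact local Smith–McMillan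 form $$R(\lambda)N_r(\lambda)=\hat M_r(\lambda)\operatorname{diag}\bigl((\lambda-\lambda_0)^{-\ell}I_{e_0},(\lambda-\lambda_0)^{1-\ell}I_{e_1},\dots,(\lambda-\lambda_0)^{d'-\ell}I_{e_{d'}}\bigr),$$ where the exponents on the diagonal are the structural indices of $R$ at $\lambda_0$, $N_r$ has a polynomial left inverse, and $\hat M_r$ has no pole at $\lambda_0$ and $\hat M_r(\lambda_0)$ has a left inverse. -/

import Mathlib

open Polynomial

noncomputable section

/-! ### Column partitions -/

section Columns

variable {μ α : Type*} {n s : ℕ}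

/-- The identification `{0, …, s-1} ⊔ {0, …, n-s-1} ≃ {0, …, n-1}`, first block first. -/
def splitEquiv (h : s ≤ n) : Fin s ⊕ Fin (n - s) ≃ Fin n :=
  finSumFinEquiv.trans (finCongr (Nat.add_sub_cancel' h))

/-- The first `s` columns of a matrix with `n` columns. -/
def firstCols (h : s ≤ n) (A : Matrix μ (Fin n) α) : Matrix μ (Fin s) α :=
  A.submatrix id (fun j => splitEquiv h (Sum.inl j))

/-- The last `n - s` columns of a matrix with `n` columns. -/
def lastCols (h : s ≤ n) (A : Matrix μ (Fin n) α) : Matrix μ (Fin (n - s)) α :=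
  A.submatrix id (fun j => splitEquiv h (Sum.inr j))

/-- The matrix `[L, R]`. -/
def joinCols (h : s ≤ n) (L : Matrix μ (Fin s) α) (R : Matrix μ (Fin (n - s)) α) :
    Matrix μ (Fin n) α :=
  (Matrix.fromCols L R).submatrix id (splitEquiv h).symm

end Columns

/-! ### Polynomial and rational matrices -/

section RationalMatrices

variable {μ ν : Type*}

/-- A polynomial matrix regarded as a rational matrix. -/
def toRat (P : Matrix μ ν ℂ[X]) : Matrix μ ν (RatFunc ℂ) :=
  P.map (algebraMap ℂ[X] (RatFunc ℂ))

/-- The `k`-th coefficient matrix of the expansion of a polynomial matrix in powers of `λ - a`. -/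
def taylorCoeff (P : Matrix μ ν ℂ[X]) (a : ℂ) (k : ℕ) : Matrix μ ν ℂ :=
  P.map (fun p => (Polynomial.taylor a p).coeff k)

open scoped RatFunc in
/-- The `k`-th coefficient matrix of the Laurent expansion at `a` of a rational matrix. -/
def laurentCoeff (R : Matrix μ ν (RatFunc ℂ)) (a : ℂ) (k : ℤ) : Matrix μ ν ℂ :=
  R.map (fun f => (algebraMap (RatFunc ℂ) (LaurentSeries ℂ) (RatFunc.laurent a f)).coeff k)

/-- The point `a` is not a pole of any entry of `R`. -/
def IsRegularAt (R : Matrix μ ν (RatFunc ℂ)) (a : ℂ) : Prop :=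
  ∀ i j, (R i j).denom.eval a ≠ 0

/-- The value `R(a)` of a rational matrix (meaningful when `a` is not a pole). -/
def evalAt (R : Matrix μ ν (RatFunc ℂ)) (a : ℂ) : Matrix μ ν ℂ :=
  R.map (RatFunc.eval (RingHom.id ℂ) a)

/-- The rational function `λ - a`. -/
def lin (a : ℂ) : RatFunc ℂ := RatFunc.X - RatFunc.C a

end RationalMatrices

variable {m n : ℕ}

/-- The `m × n` matrix with upper left block `diag((λ-a)^σ₁, …, (λ-a)^σᵣ)` and zeros elsewhere. -/
def localSmithMatrix (m n : ℕ) {r : ℕ} (a : ℂ) (σ : Fin r → ℤ) :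
    Matrix (Fin m) (Fin n) (RatFunc ℂ) :=
  Matrix.of fun i j =>
    if h : i.val = j.val ∧ i.val < r then lin a ^ σ ⟨i.val, h.2⟩ else 0

/-- `σ₁ ≤ … ≤ σᵣ` are the structural indices of `R` at `a`: `r` is the normal rank of `R`, and
`R` has a local Smith-McMillan form at `a` with diagonal entries `(λ-a)^σᵢ`. -/
structure IsStructuralIndices {r : ℕ} (R : Matrix (Fin m) (Fin n) (RatFunc ℂ)) (a : ℂ)
    (σ : Fin r → ℤ) : Prop where
  rank_eq : R.rank = r
  monotone : Monotone σ
  exists_form : ∃ (M : Matrix (Fin m) (Fin m) (RatFunc ℂ)) (N : Matrix (Fin n) (Fin n) (RatFunc ℂ)),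
    IsRegularAt M a ∧ IsRegularAt N a ∧ IsUnit (evalAt M a) ∧ IsUnit (evalAt N a) ∧
      M * R * N = localSmithMatrix m n a σ

/-- `R Nᵣ = M̂ᵣ diag((λ-a)^σ₁, …, (λ-a)^σᵣ)` is a (right) compact local Smith-McMillan form of the
rational matrix `R` at `a`. -/
structure IsCompactLocalSmithMcMillan {r : ℕ} (R : Matrix (Fin m) (Fin n) (RatFunc ℂ)) (a : ℂ)
    (σ : Fin r → ℤ) (Nr : Matrix (Fin n) (Fin r) ℂ[X]) (Mr : Matrix (Fin m) (Fin r) (RatFunc ℂ)) :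
    Prop where
  structuralIndices : IsStructuralIndices R a σ
  factorization : R * toRat Nr = Mr * Matrix.diagonal (fun j => lin a ^ σ j)
  polynomial_left_inverse : ∃ Y : Matrix (Fin r) (Fin n) ℂ[X], Y * Nr = 1
  regular : IsRegularAt Mr a
  left_invertible : ∃ Y : Matrix (Fin r) (Fin m) ℂ, Y * evalAt Mr a = 1

/-- `P Nᵣ = M̂ᵣ diag((λ-a)^σ₁, …, (λ-a)^σᵣ)` is a (right) compact local Smith form of the
polynomial matrix `P` at `a`; here `M̂ᵣ` is polynomial as well. -/
structure IsCompactLocalSmith {r : ℕ} (P : Matrix (Fin m) (Fin n) ℂ[X]) (a : ℂ)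
    (σ : Fin r → ℕ) (Nr : Matrix (Fin n) (Fin r) ℂ[X]) (Mr : Matrix (Fin m) (Fin r) ℂ[X]) :
    Prop where
  structuralIndices : IsStructuralIndices (toRat P) a (fun j => (σ j : ℤ))
  factorization : P * Nr = Mr * Matrix.diagonal (fun j => (X - C a) ^ σ j)
  polynomial_left_inverse : ∃ Y : Matrix (Fin r) (Fin n) ℂ[X], Y * Nr = 1
  left_invertible : ∃ Y : Matrix (Fin r) (Fin m) ℂ, Y * Mr.map (Polynomial.eval a) = 1

/-! ### The Toeplitz rank search -/

/-- The block upper triangular Toeplitz matrix `T_k` with `k + 1` block rows and columns and first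
block row `A₀, A₁, …, A_k`. -/
def blockToeplitz (A : ℕ → Matrix (Fin m) (Fin n) ℂ) (k : ℕ) :
    Matrix (Fin (k + 1) × Fin m) (Fin (k + 1) × Fin n) ℂ :=
  Matrix.of fun p q => if p.1 ≤ q.1 then A (q.1.val - p.1.val) p.2 q.2 else 0

/-- `X` is the Moore-Penrose inverse of `L` (the four Penrose equations). -/
structure IsMoorePenrose {μ ν : Type*} [Fintype μ] [Fintype ν] (L : Matrix μ ν ℂ)
    (X : Matrix ν μ ℂ) : Prop where
  mul_mul_left : L * X * L = L
  mul_mul_right : X * L * X = X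
  left_hermitian : (L * X).IsHermitian
  right_hermitian : (X * L).IsHermitian

/-- `N = [[I, Z], [0, I]] · diag(I, Q)` is an admissible column compression of `B = [L, R]`, where
`L` consists of the first `s` columns of `B`. Here `Z = -L†R`, and `Q` is a unitary matrix that
compresses the columns of `(I - LL†)R` to `e` independent columns:
`(I - LL†)RQ = [L₊, 0]` with `L₊` of full column rank `e`. -/
def IsSearchTransformation {s : ℕ} (hs : s ≤ n) (e : ℕ) (B : Matrix (Fin m) (Fin n) ℂ)
    (N : Matrix (Fin n) (Fin n) ℂ) : Prop :=
  ∃ (Lpinv : Matrix (Fin s) (Fin m) ℂ) (Z : Matrix (Fin s) (Fin (n - s)) ℂ)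
    (Q : Matrix (Fin (n - s)) (Fin (n - s)) ℂ) (he : e ≤ n - s),
    IsMoorePenrose (firstCols hs B) Lpinv ∧
    Z = -(Lpinv * lastCols hs B) ∧
    Q ∈ Matrix.unitaryGroup (Fin (n - s)) ℂ ∧
    (firstCols he ((1 - firstCols hs B * Lpinv) * lastCols hs B * Q)).rank = e ∧
    lastCols he ((1 - firstCols hs B * Lpinv) * lastCols hs B * Q) = 0 ∧
    N = Matrix.reindex (splitEquiv hs) (splitEquiv hs)
      (Matrix.fromBlocks 1 Z 0 1 * Matrix.fromBlocks 1 0 0 Q)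

/-- A run of the Toeplitz rank search on the coefficient sequence `A₀, A₁, A₂, …`.
The indices of `rk` and `coef` are shifted by one, so that they start with the initial data:
`rk i` is `ρ_{i-1}` and `coef i k` is the `k`-th coefficient of `P^{(i-1)}`, with `ρ_{-1} = 0` and
`P^{(-1)} = A`. The run is continued through all steps `i = 0, 1, 2, …`; where it may be stopped
is not part of the definition. -/
structure ToeplitzRankSearch (A : ℕ → Matrix (Fin m) (Fin n) ℂ) where
  /-- `rk i = ρ_{i-1}` -/
  rk : ℕ → ℕ
  /-- the rank increments `e_i = ρ_i - ρ_{i-1}` -/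
  e : ℕ → ℕ
  /-- `coef i k` is the `k`-th coefficient matrix of `P^{(i-1)}` -/
  coef : ℕ → ℕ → Matrix (Fin m) (Fin n) ℂ
  /-- the transformation `N_i` of step `i` -/
  N : ℕ → Matrix (Fin n) (Fin n) ℂ
  rk_le : ∀ i, rk i ≤ n
  rk_zero : rk 0 = 0
  rk_succ : ∀ i, rk (i + 1) = rk i + e i
  coef_zero : coef 0 = A
  /-- step `i` compresses the columns of `[L₀^{(i-1)}, R₁^{(i-1)}] = P^{(i-1)}₀` -/
  compress : ∀ i, IsSearchTransformation (rk_le i) (e i) (coef i 0) (N i)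
  /-- after the multiplication by `N_i`, the sub-blocks formed by the last `n - ρ_i` columns are
  shifted by one position -/
  shift : ∀ i k, coef (i + 1) k =
    joinCols (rk_le (i + 1)) (firstCols (rk_le (i + 1)) (coef i k * N i))
      (lastCols (rk_le (i + 1)) (coef i (k + 1) * N i))

namespace ToeplitzRankSearch

variable {A : ℕ → Matrix (Fin m) (Fin n) ℂ} (S : ToeplitzRankSearch A)

/-- The rank `ρ_i` reached in step `i`. -/
def rho (i : ℕ) : ℕ := S.rk (i + 1)

lemma rho_le (i : ℕ) : S.rho i ≤ n := S.rk_le (i + 1)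

/-- The block `L₀^{(i)}`: the first `ρ_i` columns of the compressed matrix
`[L₀^{(i-1)}, R₁^{(i-1)}] N_i`. -/
def L0 (i : ℕ) : Matrix (Fin m) (Fin (S.rho i)) ℂ :=
  firstCols (S.rho_le i) (S.coef i 0 * S.N i)

/-- `Λ_i(λ) = diag(I_{ρ_i}, (λ-a) I_{n-ρ_i})`. -/
def Lam (a : ℂ) (i : ℕ) : Matrix (Fin n) (Fin n) ℂ[X] :=
  Matrix.diagonal fun j => if j.val < S.rho i then 1 else X - C a

/-- The product `Λ_0 Λ_1 ⋯ Λ_{t-1}`. -/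
def LamProd (a : ℂ) (t : ℕ) : Matrix (Fin n) (Fin n) ℂ[X] :=
  ((List.range t).map (S.Lam a)).prod

/-- The rational matrix `N_0 Λ_0⁻¹ N_1 Λ_1⁻¹ ⋯ N_{t-1} Λ_{t-1}⁻¹ · (Λ_0 Λ_1 ⋯ Λ_{t-1})`. -/
def transform (a : ℂ) (t : ℕ) : Matrix (Fin n) (Fin n) (RatFunc ℂ) :=
  ((List.range t).map
    (fun i => (S.N i).map (RatFunc.C : ℂ →+* RatFunc ℂ) * (toRat (S.Lam a i))⁻¹)).prod *
    toRat (S.LamProd a t)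

/-- `D = diag(I_{e_0}, (λ-a) I_{e_1}, …, (λ-a)^{t-1} I_{e_{t-1}}, (λ-a)^t I_{n-ρ_{t-1}})`, with
consecutive diagonal blocks. -/
structure IsIndexDiag (a : ℂ) (t : ℕ) (D : Matrix (Fin n) (Fin n) ℂ[X]) : Prop where
  off_diag : ∀ i j, i ≠ j → D i j = 0
  block : ∀ i < t, ∀ j : Fin n, S.rk i ≤ j.val → j.val < S.rk i + S.e i → D j j = (X - C a) ^ i
  last : ∀ j : Fin n, S.rk t ≤ j.val → D j j = (X - C a) ^ t

end ToeplitzRankSearch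

end

/-! Write G_i for `P * S.stepProd a i`, which is the series P^{(i-1)} of the search. The relation
G_i N_i = G_{i+1} Λ_i drives everything. The columns of G_i N_i beyond the first ρ_i vanish at a, so
dividing them by λ - a creates no pole and shifts their coefficients by one place, exactly as the
search prescribes (`coeff_stepProd`).

Toeplitz ranks. Multiplying T_{k+1} by I ⊗ N_i and permuting columns splits off a block of rank ρ_i
and leaves the Toeplitz matrix T_k of the next coefficient sequence (`rank_blockToeplitz_succ`).

Unimodularity. N_i fixes the first ρ_{i-1} unit vectors, and all later columns carry the largest
exponent in Λ_0 ⋯ Λ_{i-1}. Conjugating N_i by that product therefore gives a polynomial matrix with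
constant nonzero determinant (`exists_lamProd_conj`), and N(λ) is a product of such matrices.

Termination. L_0^{(i)} has independent columns and consists of values at a of columns of G_{i+1},
whence ρ_i ≤ r. If ρ_i < r for all i, then fewer than r columns of Λ_0 ⋯ Λ_{t-1} are not divisible
by (λ - a)^t, so every r × r minor of P is divisible by arbitrarily high powers of λ - a. This
contradicts rank r (`exists_rho_eq_rank`).

Structural indices. When ρ_d = r, the first r columns F of G_{d+1} are independent at a and span its
column space, so G_{d+1} = F [I, *] over the local ring at a. A row transformation takes F to [I;
0], and column operations remove * because its columns carry the largest exponent
(`isStructuralIndices`). -/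

noncomputable section


/-! ### Column blocks of a matrix. -/

section ColumnLemmas

variable {μ α : Type*} {n s : ℕ}

@[simp] lemma splitEquiv_inl_val (h : s ≤ n) (j : Fin s) :
    (splitEquiv h (Sum.inl j)).val = j.val := by
  simp [splitEquiv]

@[simp] lemma splitEquiv_inr_val (h : s ≤ n) (j : Fin (n - s)) :
    (splitEquiv h (Sum.inr j)).val = s + j.val := by
  simp [splitEquiv]

lemma splitEquiv_cases (h : s ≤ n) (j : Fin n) :
    (∃ i : Fin s, j = splitEquiv h (Sum.inl i) ∧ j.val = i.val) ∨
      ∃ i : Fin (n - s), j = splitEquiv h (Sum.inr i) ∧ j.val = s + i.val := by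
  obtain ⟨x, rfl⟩ := (splitEquiv h).surjective j
  rcases x with i | i
  · exact Or.inl ⟨i, rfl, by simp⟩
  · exact Or.inr ⟨i, rfl, by simp⟩

@[simp] lemma firstCols_apply (h : s ≤ n) (A : Matrix μ (Fin n) α) (i : μ) (j : Fin s) :
    firstCols h A i j = A i (splitEquiv h (Sum.inl j)) := rfl

@[simp] lemma lastCols_apply (h : s ≤ n) (A : Matrix μ (Fin n) α) (i : μ) (j : Fin (n - s)) :
    lastCols h A i j = A i (splitEquiv h (Sum.inr j)) := rfl

@[simp] lemma joinCols_inl (h : s ≤ n) (L : Matrix μ (Fin s) α) (R : Matrix μ (Fin (n - s)) α)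
    (i : μ) (j : Fin s) : joinCols h L R i (splitEquiv h (Sum.inl j)) = L i j := by
  simp [joinCols]

@[simp] lemma joinCols_inr (h : s ≤ n) (L : Matrix μ (Fin s) α) (R : Matrix μ (Fin (n - s)) α)
    (i : μ) (j : Fin (n - s)) : joinCols h L R i (splitEquiv h (Sum.inr j)) = R i j := by
  simp [joinCols]

lemma joinCols_firstCols_lastCols (h : s ≤ n) (A : Matrix μ (Fin n) α) :
    joinCols h (firstCols h A) (lastCols h A) = A := by
  ext i j
  rcases splitEquiv_cases h j with ⟨j, rfl, -⟩ | ⟨j, rfl, -⟩ <;> simp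

lemma firstCols_joinCols (h : s ≤ n) (L : Matrix μ (Fin s) α) (R : Matrix μ (Fin (n - s)) α) :
    firstCols h (joinCols h L R) = L := by
  ext i j; simp

lemma lastCols_joinCols (h : s ≤ n) (L : Matrix μ (Fin s) α) (R : Matrix μ (Fin (n - s)) α) :
    lastCols h (joinCols h L R) = R := by
  ext i j; simp

lemma joinCols_apply_of_lt (h : s ≤ n) (A B : Matrix μ (Fin n) α) (i : μ) {j : Fin n}
    (hj : j.val < s) : joinCols h (firstCols h A) (lastCols h B) i j = A i j := by
  rcases splitEquiv_cases h j with ⟨j, rfl, -⟩ | ⟨j, rfl, hj'⟩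
  · simp
  · omega

lemma joinCols_apply_of_le (h : s ≤ n) (A B : Matrix μ (Fin n) α) (i : μ) {j : Fin n}
    (hj : s ≤ j.val) : joinCols h (firstCols h A) (lastCols h B) i j = B i j := by
  rcases splitEquiv_cases h j with ⟨j, rfl, hj'⟩ | ⟨j, rfl, hj'⟩
  · omega
  · simp

lemma sum_splitEquiv {M : Type*} [AddCommMonoid M] (h : s ≤ n) (f : Fin n → M) :
    ∑ j, f j = ∑ j : Fin s, f (splitEquiv h (Sum.inl j)) +
      ∑ j : Fin (n - s), f (splitEquiv h (Sum.inr j)) := by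
  rw [← (splitEquiv h).sum_comp, Fintype.sum_sum_type]

lemma mul_firstCols {κ : Type*} [Fintype μ] [NonUnitalNonAssocSemiring α] (h : s ≤ n)
    (B : Matrix κ μ α) (A : Matrix μ (Fin n) α) : B * firstCols h A = firstCols h (B * A) := rfl

lemma mulVec_splitEquiv [NonUnitalNonAssocSemiring α] (h : s ≤ n) (A : Matrix μ (Fin n) α)
    (x : Fin n → α) :
    A.mulVec x = (firstCols h A).mulVec (fun j => x (splitEquiv h (Sum.inl j))) +
      (lastCols h A).mulVec (fun j => x (splitEquiv h (Sum.inr j))) := by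
  ext i
  simp [Matrix.mulVec, dotProduct, sum_splitEquiv h]

end ColumnLemmas

/-! ### Full column rank and left inverses. -/

section FullColumnRank

variable {F μ ν : Type*} [Field F] [Fintype ν]

lemma Matrix.mulVec_injective_iff_rank [Fintype μ] (A : Matrix μ ν F) :
    Function.Injective A.mulVec ↔ A.rank = Fintype.card ν := by
  have h := A.mulVecLin.finrank_range_add_finrank_ker
  rw [Module.finrank_pi] at h
  rw [Matrix.rank, ← Matrix.coe_mulVecLin, ← LinearMap.ker_eq_bot, ← Submodule.finrank_eq_zero
    (R := F)]
  omega

lemma Matrix.exists_mul_eq_one_of_mulVec_injective [Fintype μ] [DecidableEq ν] [DecidableEq μ]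
    {A : Matrix μ ν F}
    (h : Function.Injective A.mulVec) : ∃ Y : Matrix ν μ F, Y * A = 1 := by
  obtain ⟨g, hg⟩ := A.mulVecLin.exists_leftInverse_of_injective
    (LinearMap.ker_eq_bot.2 h)
  refine ⟨LinearMap.toMatrix' g, ?_⟩
  have := congrArg LinearMap.toMatrix' hg
  rw [LinearMap.toMatrix'_comp, LinearMap.toMatrix'_id] at this
  rwa [← Matrix.toLin'_apply', LinearMap.toMatrix'_toLin'] at this

lemma Matrix.mulVec_injective_of_mul_eq_one [Fintype μ] [DecidableEq ν] {A : Matrix μ ν F}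
    {Y : Matrix ν μ F} (h : Y * A = 1) : Function.Injective A.mulVec := by
  intro x y hxy
  have := congrArg Y.mulVec hxy
  simpa [Matrix.mulVec_mulVec, h] using this

lemma Matrix.rank_joinCols_zero [Fintype μ] {n s : ℕ} (h : s ≤ n) (L : Matrix μ (Fin s) F) :
    (joinCols h L 0).rank = L.rank := by
  have : Set.range (joinCols h L 0).mulVec = Set.range L.mulVec := by
    ext y
    constructor
    · rintro ⟨x, rfl⟩
      refine ⟨fun j => x (splitEquiv h (Sum.inl j)), ?_⟩
      rw [mulVec_splitEquiv h, firstCols_joinCols, lastCols_joinCols]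
      simp
    · rintro ⟨x, rfl⟩
      refine ⟨fun j => Sum.elim x 0 ((splitEquiv h).symm j), ?_⟩
      rw [mulVec_splitEquiv h, firstCols_joinCols, lastCols_joinCols]
      simp
  have h2 : LinearMap.range (joinCols h L 0).mulVecLin = LinearMap.range L.mulVecLin :=
    SetLike.coe_injective (by simpa only [LinearMap.coe_range, Matrix.coe_mulVecLin] using this)
  rw [Matrix.rank, Matrix.rank, h2]

end FullColumnRank

/-! ### One step of the search, and existence of the search. -/

section SearchStep

variable {m n : ℕ}

lemma IsMoorePenrose.mul_eq_one {μ ν : Type*} [Fintype μ] [Fintype ν] [DecidableEq ν]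
    {L : Matrix μ ν ℂ} {X : Matrix ν μ ℂ} (h : IsMoorePenrose L X)
    (hL : Function.Injective L.mulVec) : X * L = 1 := by
  apply Matrix.mulVec_injective
  ext1 v
  apply hL
  rw [Matrix.mulVec_mulVec, ← Matrix.mul_assoc, h.mul_mul_left, Matrix.one_mulVec]

open scoped ComplexOrder in
-- For independent columns the Gram matrix L*L is invertible, and (L*L)⁻¹L* satisfies the four
-- Penrose equations.
lemma exists_isMoorePenrose {μ ν : Type*} [Fintype μ] [Fintype ν] [DecidableEq ν]
    {L : Matrix μ ν ℂ} (hL : Function.Injective L.mulVec) : ∃ X, IsMoorePenrose L X := by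
  have hu : IsUnit (L.conjTranspose * L) := by
    rw [← Matrix.mulVec_injective_iff_isUnit, Matrix.mulVec_injective_iff_rank,
      Matrix.rank_conjTranspose_mul_self, ← Matrix.mulVec_injective_iff_rank]
    exact hL
  have hd := (Matrix.isUnit_iff_isUnit_det _).1 hu
  have h1 : (L.conjTranspose * L)⁻¹ * L.conjTranspose * L = 1 := by
    rw [Matrix.mul_assoc, Matrix.nonsing_inv_mul _ hd]
  have hh : (L.conjTranspose * L).IsHermitian := Matrix.isHermitian_conjTranspose_mul_self L
  refine ⟨(L.conjTranspose * L)⁻¹ * L.conjTranspose, ?_, ?_, ?_, ?_⟩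
  · rw [Matrix.mul_assoc, h1, Matrix.mul_one]
  · rw [h1, Matrix.one_mul]
  · rw [Matrix.IsHermitian]
    simp only [Matrix.conjTranspose_mul, Matrix.conjTranspose_conjTranspose, hh.inv.eq,
      Matrix.mul_assoc]
  · rw [h1]
    exact Matrix.isHermitian_one

open scoped ComplexOrder in
/-- Unitary column compression. -/
lemma exists_unitary_compression {b : ℕ} (W : Matrix (Fin m) (Fin b) ℂ) :
    ∃ (e : ℕ) (he : e ≤ b), ∃ Q ∈ Matrix.unitaryGroup (Fin b) ℂ,
      (firstCols he (W * Q)).rank = e ∧ lastCols he (W * Q) = 0 := by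
  have hH : (W.conjTranspose * W).IsHermitian := Matrix.isHermitian_conjTranspose_mul_self W
  -- The columns of Q are orthonormal eigenvectors of W*W. Those with eigenvalue zero lie in the
  -- kernel of W, and their number is b - rank W.
  set U : Matrix (Fin b) (Fin b) ℂ := ↑hH.eigenvectorUnitary with hU
  have hUmem : U ∈ Matrix.unitaryGroup (Fin b) ℂ := hH.eigenvectorUnitary.2
  have hUu : IsUnit U := IsUnit.of_mul_eq_one_right _ (Matrix.mem_unitaryGroup_iff'.1 hUmem)
  let p : Fin b → Prop := fun j => hH.eigenvalues j ≠ 0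
  classical
  have hcard : Fintype.card {j // p j} = W.rank := by
    rw [← Matrix.rank_conjTranspose_mul_self W]
    exact (hH.rank_eq_card_non_zero_eigs).symm
  set e := W.rank with he_def
  have he : e ≤ b := by simpa using W.rank_le_card_width
  have hcard' : Fintype.card {j // ¬ p j} = b - e := by
    rw [Fintype.card_subtype_compl, hcard, Fintype.card_fin]
  -- Reordering that puts the eigenvectors with nonzero eigenvalue first.
  let π : Fin b ≃ Fin b := (splitEquiv he).symm.trans
    (((Fintype.equivFinOfCardEq hcard).symm.sumCongr
      (Fintype.equivFinOfCardEq hcard').symm).trans (Equiv.sumCompl p))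
  have hπ : ∀ j : Fin (b - e), hH.eigenvalues (π (splitEquiv he (Sum.inr j))) = 0 := by
    intro j
    have := ((Fintype.equivFinOfCardEq hcard').symm j).2
    simpa [π, p] using this
  have hlast : lastCols he (W * U.submatrix id π) = 0 := by
    ext i j
    have hz : W.mulVec (hH.eigenvectorBasis (π (splitEquiv he (Sum.inr j)))) = 0 := by
      have h1 := hH.mulVec_eigenvectorBasis (π (splitEquiv he (Sum.inr j)))
      rw [hπ, zero_smul, ← Matrix.mulVec_mulVec] at h1
      exact Matrix.conjTranspose_mul_self_mulVec_eq_zero .. |>.1 (by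
        rw [← Matrix.mulVec_mulVec]; exact h1)
    have := congrFun hz i
    simpa [Matrix.mul_apply, Matrix.mulVec, dotProduct, hU,
      Matrix.IsHermitian.eigenvectorUnitary_apply] using this
  refine ⟨e, he, U.submatrix id π, ?_, ?_, hlast⟩
  · rw [Matrix.mem_unitaryGroup_iff']
    have := Matrix.mem_unitaryGroup_iff'.1 hUmem
    ext i j
    have := congrFun (congrFun this (π i)) (π j)
    simpa [Matrix.mul_apply, Matrix.one_apply] using this
  · have h2 : (W * U.submatrix id π).rank = e := by
      have : W * U.submatrix id π = (W * U).submatrix (Equiv.refl _) π := by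
        ext; simp [Matrix.mul_apply]
      rw [this, Matrix.rank_submatrix, Matrix.rank_mul_eq_left_of_isUnit_det]
      exact (Matrix.isUnit_iff_isUnit_det _).1 hUu
    rw [← joinCols_firstCols_lastCols he (W * U.submatrix id π), hlast,
      Matrix.rank_joinCols_zero] at h2
    exact h2

/-- The block structure of a search transformation and its effect on the compressed matrix. -/
structure SearchStepSpec {s : ℕ} (e : ℕ) (B : Matrix (Fin m) (Fin n) ℂ)
    (N : Matrix (Fin n) (Fin n) ℂ) (h : s + e ≤ n) : Prop where
  last_eq_zero : ∀ i, ∀ j : Fin n, s + e ≤ j.val → (B * N) i j = 0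
  injective : Function.Injective (firstCols h (B * N)).mulVec
  isUnit : IsUnit N
  first_columns : ∀ i j : Fin n, j.val < s → N i j = if i = j then 1 else 0

/-- Here BN = [L, W] with W = (I - LX)RQ, and independence of the columns of L turns the Penrose
equations into XL = I and XW = 0. Applying X to a relation Lu + Wv = 0 gives u = 0, and the full
column rank of L₊ then gives v = 0. -/
lemma IsSearchTransformation.spec {s : ℕ} {hs : s ≤ n} {e : ℕ} {B : Matrix (Fin m) (Fin n) ℂ}
    {N : Matrix (Fin n) (Fin n) ℂ} (hN : IsSearchTransformation hs e B N)
    (hB : Function.Injective (firstCols hs B).mulVec) (h : s + e ≤ n) :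
    SearchStepSpec (s := s) e B N h := by
  obtain ⟨X, Z, Q, he, hX, rfl, hQ, hrank, hlast, hNeq⟩ := hN
  have hXL := hX.mul_eq_one hB
  set L := firstCols hs B with hL
  set R := lastCols hs B with hR
  set W := (1 - L * X) * R * Q with hW
  have hN1 : ∀ i j, N i (splitEquiv hs (Sum.inl j)) =
      if i = splitEquiv hs (Sum.inl j) then 1 else 0 := by
    intro i j
    rw [hNeq, Matrix.fromBlocks_multiply]
    obtain ⟨i, rfl⟩ := (splitEquiv hs).surjective i
    rcases i with i | i
    · simp [Matrix.one_apply]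
    · simp
  have hN2 : ∀ i j, N (splitEquiv hs (Sum.inl i)) (splitEquiv hs (Sum.inr j)) =
      (-(X * R) * Q) i j := by
    intro i j; rw [hNeq, Matrix.fromBlocks_multiply]; simp
  have hN3 : ∀ i j, N (splitEquiv hs (Sum.inr i)) (splitEquiv hs (Sum.inr j)) = Q i j := by
    intro i j; rw [hNeq, Matrix.fromBlocks_multiply]; simp
  have hfirst : firstCols hs (B * N) = L := by
    ext i j
    simp [Matrix.mul_apply, hN1, hL]
  have hsecond : lastCols hs (B * N) = W := by
    have : W = L * (-(X * R) * Q) + R * Q := by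
      rw [hW]
      simp only [Matrix.sub_mul, Matrix.neg_mul, Matrix.mul_neg, Matrix.one_mul, Matrix.mul_assoc]
      abel
    rw [this]
    ext i j
    rw [lastCols_apply, Matrix.mul_apply, sum_splitEquiv hs, Matrix.add_apply, Matrix.mul_apply,
      Matrix.mul_apply]
    simp [hN2, hN3, hL, hR]
  have hXW : X * W = 0 := by
    rw [hW, ← Matrix.mul_assoc, ← Matrix.mul_assoc, Matrix.mul_sub, Matrix.mul_one,
      ← Matrix.mul_assoc, hX.mul_mul_right, sub_self, Matrix.zero_mul, Matrix.zero_mul]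
  have hinj : Function.Injective (firstCols he W).mulVec := by
    rw [Matrix.mulVec_injective_iff_rank, hrank, Fintype.card_fin]
  have hzero : ∀ i, ∀ j : Fin n, s + e ≤ j.val → (B * N) i j = 0 := by
    intro i j hj
    rcases splitEquiv_cases hs j with ⟨j', rfl, hj'⟩ | ⟨j', rfl, hj'⟩
    · omega
    · change lastCols hs (B * N) i j' = 0
      rw [hsecond]
      rcases splitEquiv_cases he j' with ⟨k, rfl, hk⟩ | ⟨k, rfl, hk⟩
      · omega
      · exact congrFun (congrFun hlast i) k
  refine ⟨hzero, ?_, ?_, ?_⟩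
  · rw [← Matrix.coe_mulVecLin, injective_iff_map_eq_zero]
    intro y hy
    let x : Fin n → ℂ := fun j => Sum.elim y 0 ((splitEquiv h).symm j)
    have hxl : ∀ j, x (splitEquiv h (Sum.inl j)) = y j := by intro j; simp [x]
    have hxr : ∀ j : Fin n, s + e ≤ j.val → x j = 0 := by
      intro j hj
      rcases splitEquiv_cases h j with ⟨j, rfl, hj'⟩ | ⟨j, rfl, hj'⟩
      · omega
      · simp [x]
    have hBx : (B * N).mulVec x = 0 := by
      rw [mulVec_splitEquiv h]
      have : (fun j => x (splitEquiv h (Sum.inr j))) = 0 := by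
        ext j; exact hxr _ (by simp)
      rw [this, Matrix.mulVec_zero, add_zero]
      simpa [hxl] using hy
    rw [mulVec_splitEquiv hs, hfirst, hsecond] at hBx
    have h1 := congrArg X.mulVec hBx
    rw [Matrix.mulVec_add, Matrix.mulVec_mulVec, Matrix.mulVec_mulVec, hXL, hXW,
      Matrix.one_mulVec, Matrix.zero_mulVec, add_zero, Matrix.mulVec_zero] at h1
    rw [h1, Matrix.mulVec_zero, zero_add, mulVec_splitEquiv he] at hBx
    have h2 : (fun j => x (splitEquiv hs (Sum.inr (splitEquiv he (Sum.inr j))))) = 0 := by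
      ext j; exact hxr _ (by simp)
    rw [h2, Matrix.mulVec_zero, add_zero, ← Matrix.mulVec_zero (firstCols he W)] at hBx
    have h3 := hinj hBx
    ext j
    rw [← hxl]
    rcases splitEquiv_cases hs (splitEquiv h (Sum.inl j)) with ⟨k, hk, -⟩ | ⟨k, hk, hk'⟩
    · rw [hk]; exact congrFun h1 k
    · rw [hk]
      rcases splitEquiv_cases he k with ⟨k, rfl, -⟩ | ⟨k, rfl, hk''⟩
      · exact congrFun h3 k
      · have := j.2
        simp at hk'
        omega
  · have hQu : IsUnit Q.det := by
      rw [← Matrix.isUnit_iff_isUnit_det]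
      exact IsUnit.of_mul_eq_one_right _ (Matrix.mem_unitaryGroup_iff'.1 hQ)
    rw [Matrix.isUnit_iff_isUnit_det, hNeq, Matrix.det_reindex_self, Matrix.det_mul,
      Matrix.det_fromBlocks_zero₂₁, Matrix.det_fromBlocks_zero₂₁]
    simpa using hQu
  · intro i j hj
    rcases splitEquiv_cases hs j with ⟨j, rfl, -⟩ | ⟨j, rfl, hj'⟩
    · exact hN1 i j
    · omega

lemma exists_isSearchTransformation {s : ℕ} (hs : s ≤ n) (B : Matrix (Fin m) (Fin n) ℂ)
    (hB : Function.Injective (firstCols hs B).mulVec) :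
    ∃ e N, s + e ≤ n ∧ IsSearchTransformation hs e B N := by
  obtain ⟨X, hX⟩ := exists_isMoorePenrose hB
  obtain ⟨e, he, Q, hQ, h1, h2⟩ :=
    exists_unitary_compression ((1 - firstCols hs B * X) * lastCols hs B)
  exact ⟨e, _, by omega, X, _, Q, he, hX, rfl, hQ, h1, h2, rfl⟩

/-- A state of the search: the current rank and coefficients, whose leading coefficient has
linearly independent first columns. -/
structure SearchState (m n : ℕ) where
  rk : ℕ
  rk_le : rk ≤ n
  coef : ℕ → Matrix (Fin m) (Fin n) ℂ
  injective : Function.Injective (firstCols rk_le (coef 0)).mulVec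

lemma SearchState.exists_next (s : SearchState m n) :
    ∃ (t : SearchState m n) (e : ℕ) (N : Matrix (Fin n) (Fin n) ℂ),
      t.rk = s.rk + e ∧ IsSearchTransformation s.rk_le e (s.coef 0) N ∧
      ∀ k, t.coef k = joinCols t.rk_le (firstCols t.rk_le (s.coef k * N))
        (lastCols t.rk_le (s.coef (k + 1) * N)) := by
  obtain ⟨e, N, h, hN⟩ := exists_isSearchTransformation s.rk_le (s.coef 0) s.injective
  have spec := hN.spec s.injective h
  exact ⟨⟨s.rk + e, h, fun k => joinCols h (firstCols h (s.coef k * N))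
        (lastCols h (s.coef (k + 1) * N)), by rw [firstCols_joinCols]; exact spec.injective⟩,
    e, N, rfl, hN, fun k => rfl⟩

theorem ToeplitzRankSearch.nonempty (A : ℕ → Matrix (Fin m) (Fin n) ℂ) :
    Nonempty (ToeplitzRankSearch A) := by
  choose next e N h1 h2 h3 using SearchState.exists_next (m := m) (n := n)
  let s0 : SearchState m n := ⟨0, Nat.zero_le _, A, fun x y _ => Subsingleton.elim x y⟩
  let st : ℕ → SearchState m n := fun i => Nat.rec s0 (fun _ s => next s) i
  exact ⟨{ rk := fun i => (st i).rk
           e := fun i => e (st i)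
           coef := fun i => (st i).coef
           N := fun i => N (st i)
           rk_le := fun i => (st i).rk_le
           rk_zero := rfl
           rk_succ := fun i => h1 (st i)
           coef_zero := rfl
           compress := fun i => h2 (st i)
           shift := fun i k => h3 (st i) k }⟩

namespace ToeplitzRankSearch

variable {A : ℕ → Matrix (Fin m) (Fin n) ℂ} (S : ToeplitzRankSearch A)

/-- Invariant of the search: it is what makes `IsSearchTransformation.spec` applicable at every
step. -/
lemma firstCols_coef_injective (i : ℕ) :
    Function.Injective (firstCols (S.rk_le i) (S.coef i 0)).mulVec := by
  induction i with
  | zero =>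
    intro x y _
    ext j
    have := j.2
    have := S.rk_zero
    omega
  | succ i ih =>
    rw [S.shift i 0, firstCols_joinCols]
    have h : S.rk i + S.e i ≤ n := S.rk_succ i ▸ S.rk_le (i + 1)
    have := ((S.compress i).spec ih h).injective
    -- The number of columns occurs in the type, so it is generalized before the equation `rk_succ`
    -- is substituted.
    have key : ∀ s (hs : s ≤ n), s = S.rk i + S.e i →
        Function.Injective (firstCols hs (S.coef i 0 * S.N i)).mulVec := by
      rintro s hs rfl; exact this
    exact key _ _ (S.rk_succ i)

lemma rk_add_e_le (i : ℕ) : S.rk i + S.e i ≤ n := S.rk_succ i ▸ S.rk_le (i + 1)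

lemma spec (i : ℕ) : SearchStepSpec (s := S.rk i) (S.e i) (S.coef i 0) (S.N i) (S.rk_add_e_le i) :=
  (S.compress i).spec (S.firstCols_coef_injective i) _

lemma L0_injective (i : ℕ) : Function.Injective (S.L0 i).mulVec := by
  have := S.firstCols_coef_injective (i + 1)
  rwa [S.shift i 0, firstCols_joinCols] at this

lemma rank_L0 (i : ℕ) : (S.L0 i).rank = S.rho i := by
  rw [(Matrix.mulVec_injective_iff_rank _).1 (S.L0_injective i), Fintype.card_fin]

lemma coef_mul_N_eq_zero (i : ℕ) (p : Fin m) {j : Fin n} (hj : S.rho i ≤ j.val) :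
    (S.coef i 0 * S.N i) p j = 0 :=
  (S.spec i).last_eq_zero p j (S.rk_succ i ▸ hj)

lemma coef_mul_N (i : ℕ) : S.coef i 0 * S.N i = joinCols (S.rho_le i) (S.L0 i) 0 := by
  ext p j
  rcases splitEquiv_cases (S.rho_le i) j with ⟨j, rfl, -⟩ | ⟨j, rfl, hj⟩
  · rw [joinCols_inl]; rfl
  · rw [joinCols_inr, S.coef_mul_N_eq_zero i p (by omega)]; rfl

/-- The rank is ρ_i and not ρ_{i-1} = `rk i`: it counts the columns added in step i, since `coef i
0` is the matrix which that step compresses. -/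
lemma rank_coef_zero (i : ℕ) : (S.coef i 0).rank = S.rho i := by
  rw [← S.rank_L0, ← Matrix.rank_joinCols_zero (S.rho_le i), ← S.coef_mul_N,
    Matrix.rank_mul_eq_left_of_isUnit_det]
  exact (Matrix.isUnit_iff_isUnit_det _).1 (S.spec i).isUnit

lemma coef_succ_of_lt (i k : ℕ) (p : Fin m) {j : Fin n} (hj : j.val < S.rho i) :
    S.coef (i + 1) k p j = (S.coef i k * S.N i) p j := by
  rw [S.shift]
  exact joinCols_apply_of_lt (S.rho_le i) _ _ _ hj

lemma coef_succ_of_le (i k : ℕ) (p : Fin m) {j : Fin n} (hj : S.rho i ≤ j.val) :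
    S.coef (i + 1) k p j = (S.coef i (k + 1) * S.N i) p j := by
  rw [S.shift]
  exact joinCols_apply_of_le (S.rho_le i) _ _ _ hj

lemma rk_mono : Monotone S.rk :=
  monotone_nat_of_le_succ fun i => by rw [S.rk_succ]; omega

end ToeplitzRankSearch

end SearchStep


/-! ### Ranks of the block Toeplitz matrices. -/

section ToeplitzRank

variable {m n : ℕ}

/-- Under `h` the block B does not affect the kernel, which is the product of the kernels of A and
D; rank-nullity gives the rest. -/
lemma Matrix.rank_fromBlocks_zero₂₁ {F p q s t : Type*} [Field F] [Fintype p] [Fintype q]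
    [Fintype s] [Fintype t] (A : Matrix s p F) (B : Matrix s q F) (D : Matrix t q F)
    (h : ∀ y, D.mulVec y = 0 → B.mulVec y = 0) :
    (Matrix.fromBlocks A B 0 D).rank = A.rank + D.rank := by
  have key : ∀ z : p ⊕ q → F, (Matrix.fromBlocks A B 0 D).mulVec z = 0 ↔
      A.mulVec (z ∘ Sum.inl) = 0 ∧ D.mulVec (z ∘ Sum.inr) = 0 := by
    intro z
    rw [Matrix.fromBlocks_mulVec, Matrix.zero_mulVec, zero_add, ← Sum.elim_zero_zero,
      Sum.elim_eq_iff]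
    constructor
    · rintro ⟨h1, h2⟩
      exact ⟨by simpa [h _ h2] using h1, h2⟩
    · rintro ⟨h1, h2⟩
      exact ⟨by rw [h1, h _ h2, add_zero], h2⟩
  let f : LinearMap.ker (Matrix.fromBlocks A B 0 D).mulVecLin ≃ₗ[F]
      LinearMap.ker A.mulVecLin × LinearMap.ker D.mulVecLin :=
    { toFun := fun z => (⟨z.1 ∘ Sum.inl, ((key z.1).1 z.2).1⟩, ⟨z.1 ∘ Sum.inr, ((key z.1).1 z.2).2⟩)
      invFun := fun z => ⟨Sum.elim z.1.1 z.2.1, (key _).2 ⟨z.1.2, z.2.2⟩⟩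
      map_add' := fun _ _ => rfl
      map_smul' := fun _ _ => rfl
      left_inv := fun z => Subtype.ext (Sum.elim_comp_inl_inr z.1)
      right_inv := fun _ => rfl }
  have hf := f.finrank_eq
  rw [Module.finrank_prod] at hf
  have h1 := (Matrix.fromBlocks A B 0 D).mulVecLin.finrank_range_add_finrank_ker
  have h2 := A.mulVecLin.finrank_range_add_finrank_ker
  have h3 := D.mulVecLin.finrank_range_add_finrank_ker
  rw [Module.finrank_pi] at h1 h2 h3
  rw [Fintype.card_sum] at h1
  unfold Matrix.rank
  omega

open scoped Kronecker in
lemma rank_blockToeplitz_mul (A : ℕ → Matrix (Fin m) (Fin n) ℂ) (N : Matrix (Fin n) (Fin n) ℂ)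
    (hN : IsUnit N) (k : ℕ) :
    (blockToeplitz (fun k => A k * N) k).rank = (blockToeplitz A k).rank := by
  have : blockToeplitz (fun k => A k * N) k =
      blockToeplitz A k * ((1 : Matrix (Fin (k + 1)) (Fin (k + 1)) ℂ) ⊗ₖ N) := by
    ext ⟨p, i⟩ ⟨q, j⟩
    simp only [blockToeplitz, Matrix.of_apply, Matrix.mul_apply, Fintype.sum_prod_type,
      Matrix.kroneckerMap_apply, Matrix.one_apply]
    rw [Finset.sum_eq_single q]
    · split_ifs <;> simp_all
    · intro q' _ hq; simp [hq]
    · simp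
  rw [this, Matrix.rank_mul_eq_left_of_isUnit_det]
  rw [Matrix.det_kronecker]
  rw [Matrix.det_one, one_pow, one_mul]
  exact ((Matrix.isUnit_iff_isUnit_det _).1 hN).pow _

/-- The splitting of the row indices of a block Toeplitz matrix that separates the last block. -/
def toeplitzRowEquiv (m k : ℕ) : (Fin (k + 1) × Fin m) ⊕ Fin m ≃ Fin (k + 2) × Fin m :=
  Equiv.ofBijective (Sum.elim (fun x => (x.1.castSucc, x.2)) (fun i => (Fin.last _, i))) (by
    rw [Fintype.bijective_iff_injective_and_card]
    constructor
    · rintro (⟨p, i⟩ | i) (⟨q, j⟩ | j) h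
      · simpa using h
      · have := p.2
        simp [Fin.ext_iff] at h
        omega
      · have := q.2
        simp [Fin.ext_iff] at h
        omega
      · simpa using h
    · simp [add_mul]; ring)

/-- The splitting of the column indices of a block Toeplitz matrix that separates the first `ρ`
columns of the last block and the last `n - ρ` columns of the first block. -/
def toeplitzColEquiv (n ρ k : ℕ) : (Fin (k + 1) × Fin n) ⊕ Fin n ≃ Fin (k + 2) × Fin n :=
  Equiv.ofBijective (Sum.elim (fun x => (if x.2.val < ρ then x.1.castSucc else x.1.succ, x.2))
    (fun j => (if j.val < ρ then Fin.last _ else 0, j))) (by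
    rw [Fintype.bijective_iff_injective_and_card]
    constructor
    · rintro (⟨p, i⟩ | i) (⟨q, j⟩ | j) h
      · simp only [Sum.elim_inl, Prod.mk.injEq] at h
        obtain ⟨h, rfl⟩ := h
        split_ifs at h <;> simpa using h
      · have := p.2
        simp only [Sum.elim_inl, Sum.elim_inr, Prod.mk.injEq] at h
        obtain ⟨h, rfl⟩ := h
        have h := congrArg Fin.val h
        split_ifs at h <;> simp only [Fin.val_castSucc, Fin.val_succ, Fin.val_last,
          Fin.val_zero] at h <;> omega
      · have := q.2
        simp only [Sum.elim_inl, Sum.elim_inr, Prod.mk.injEq] at h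
        obtain ⟨h, rfl⟩ := h
        have h := congrArg Fin.val h
        split_ifs at h <;> simp only [Fin.val_castSucc, Fin.val_succ, Fin.val_last,
          Fin.val_zero] at h <;> omega
      · simp only [Sum.elim_inr, Prod.mk.injEq] at h
        rw [h.2]
    · simp [add_mul]; ring)

namespace ToeplitzRankSearch

variable {A : ℕ → Matrix (Fin m) (Fin n) ℂ} (S : ToeplitzRankSearch A)

lemma rank_blockToeplitz_zero (i : ℕ) : (blockToeplitz (S.coef i) 0).rank = S.rho i := by
  rw [← S.rank_coef_zero i, ← Matrix.rank_submatrix (S.coef i 0)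
    (Equiv.uniqueProd (Fin m) (Fin 1)) (Equiv.uniqueProd (Fin n) (Fin 1))]
  congr 1
  ext ⟨p, i⟩ ⟨q, j⟩
  have hp : p = 0 := Fin.fin_one_eq_zero _
  have hq : q = 0 := Fin.fin_one_eq_zero _
  subst hp hq
  simp [blockToeplitz]

/-- After multiplication by I ⊗ N_i, the columns of index at least ρ_i in the first block column are
zero. Moving them to the end, next to the first ρ_i columns of the last block column, shifts the
remaining such columns one block to the left, as the search does. The last block row then meets only
the separated columns. -/
lemma rank_blockToeplitz_succ (i k : ℕ) :
    (blockToeplitz (S.coef i) (k + 1)).rank =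
      (blockToeplitz (S.coef (i + 1)) k).rank + S.rho i := by
  rw [← rank_blockToeplitz_mul _ _ (S.spec i).isUnit, ← Matrix.rank_submatrix _
    (toeplitzRowEquiv m k) (toeplitzColEquiv n (S.rho i) k),
    ← Matrix.fromBlocks_toBlocks (Matrix.submatrix _ _ _)]
  set T := (blockToeplitz (fun k => S.coef i k * S.N i) (k + 1)).submatrix
    (toeplitzRowEquiv m k) (toeplitzColEquiv n (S.rho i) k) with hT
  have h11 : T.toBlocks₁₁ = blockToeplitz (S.coef (i + 1)) k := by
    ext ⟨p, r⟩ ⟨q, j⟩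
    rcases lt_or_ge j.val (S.rho i) with hj | hj
    · simp [hT, Matrix.toBlocks₁₁, toeplitzRowEquiv, toeplitzColEquiv, blockToeplitz, hj,
        S.coef_succ_of_lt _ _ _ hj]
    · simp only [hT, Matrix.toBlocks₁₁, toeplitzRowEquiv, toeplitzColEquiv, blockToeplitz,
        Matrix.of_apply, Matrix.submatrix_apply, Equiv.ofBijective_apply, Sum.elim_inl,
        not_lt.2 hj, if_false, S.coef_succ_of_le _ _ _ hj, Fin.le_def, Fin.val_castSucc,
        Fin.val_succ]
      -- Below the diagonal, the shifted columns still meet the block `coef i 0 * S.N i` when p = q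
      -- + 1, but there its columns vanish.
      rcases le_or_gt p.val q.val with h | h
      · rw [if_pos (by omega), if_pos h, Nat.sub_add_comm h]
      · rw [if_neg (by omega : ¬ p.val ≤ q.val)]
        split_ifs with h'
        · rw [show q.val + 1 - p.val = 0 by omega, S.coef_mul_N_eq_zero _ _ hj]
        · rfl
  have h21 : T.toBlocks₂₁ = 0 := by
    ext r ⟨q, j⟩
    have := q.2
    simp only [hT, Matrix.toBlocks₂₁, toeplitzRowEquiv, toeplitzColEquiv, blockToeplitz,
        Matrix.of_apply, Matrix.submatrix_apply, Equiv.ofBijective_apply, Sum.elim_inl,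
        Sum.elim_inr, Matrix.zero_apply]
    rcases lt_or_ge j.val (S.rho i) with hj | hj
    · rw [if_pos hj, if_neg]
      simp [Fin.le_def]
      omega
    · rw [if_neg (not_lt.2 hj)]
      split_ifs with h
      · rw [Fin.le_def, Fin.val_last, Fin.val_succ] at h
        rw [Fin.val_last, Fin.val_succ, show q.val + 1 - (k + 1) = 0 by omega,
          S.coef_mul_N_eq_zero _ _ hj]
      · rfl
  have h22 : T.toBlocks₂₂ = S.coef i 0 * S.N i := by
    ext r j
    simp only [hT, Matrix.toBlocks₂₂, toeplitzRowEquiv, toeplitzColEquiv, blockToeplitz,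
        Matrix.of_apply, Matrix.submatrix_apply, Equiv.ofBijective_apply, Sum.elim_inr]
    rcases lt_or_ge j.val (S.rho i) with hj | hj
    · simp [hj]
    · rw [if_neg (not_lt.2 hj), if_neg (by simp), S.coef_mul_N_eq_zero _ _ hj]
  -- These columns come from the first block column, whose only possibly nonzero block is `coef i 0
  -- * S.N i`. The other separated columns cause no trouble, because a kernel vector of the lower
  -- right block is zero on the independent columns of `L0`.
  have h12 : ∀ r (j : Fin n), S.rho i ≤ j.val → T.toBlocks₁₂ r j = 0 := by
    rintro ⟨p, r⟩ j hj
    simp only [hT, Matrix.toBlocks₁₂, toeplitzRowEquiv, toeplitzColEquiv, blockToeplitz,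
        Matrix.of_apply, Matrix.submatrix_apply, Equiv.ofBijective_apply, Sum.elim_inr,
        Sum.elim_inl, not_lt.2 hj, if_false, Fin.val_zero, Nat.zero_sub]
    rw [S.coef_mul_N_eq_zero _ _ hj]
    simp
  rw [h11, h21, h22, Matrix.rank_fromBlocks_zero₂₁]
  · rw [S.coef_mul_N, Matrix.rank_joinCols_zero, S.rank_L0]
  · intro y hy
    rw [S.coef_mul_N, mulVec_splitEquiv (S.rho_le i), firstCols_joinCols, lastCols_joinCols,
      Matrix.zero_mulVec, add_zero, ← Matrix.mulVec_zero (S.L0 i)] at hy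
    have hy' := S.L0_injective i hy
    have hz : lastCols (S.rho_le i) T.toBlocks₁₂ = 0 := by
      ext r j
      exact h12 _ _ (by simp)
    rw [mulVec_splitEquiv (S.rho_le i), hy', hz]
    simp

lemma rank_blockToeplitz_coef (i k : ℕ) :
    (blockToeplitz (S.coef i) k).rank = ∑ j ∈ Finset.range (k + 1), S.rho (i + j) := by
  induction k generalizing i with
  | zero => simp [rank_blockToeplitz_zero]
  | succ k ih =>
    rw [rank_blockToeplitz_succ, ih, Finset.sum_range_succ' _ (k + 1)]
    simp only [add_zero, add_assoc, add_comm 1]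

theorem rank_blockToeplitz (k : ℕ) :
    (blockToeplitz A k).rank = ∑ i ∈ Finset.range (k + 1), S.rho i := by
  have := S.rank_blockToeplitz_coef 0 k
  rwa [S.coef_zero, Finset.sum_congr rfl fun j _ => by rw [zero_add]] at this

end ToeplitzRankSearch

end ToeplitzRank


/-! ### Laurent expansions and the local ring of rational functions at a. -/

section LaurentExpansion

open scoped RatFunc

/-- The subring of the rational functions without pole at `a`. -/
def regularSubring (a : ℂ) : Subring (RatFunc ℂ) where
  carrier := {f | f.denom.eval a ≠ 0}
  mul_mem' {f g} hf hg h := by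
    obtain ⟨c, hc⟩ := RatFunc.denom_mul_dvd f g
    have := congrArg (Polynomial.eval a) hc
    rw [Polynomial.eval_mul, Polynomial.eval_mul, h, zero_mul] at this
    exact mul_ne_zero hf hg this
  one_mem' := by simp
  add_mem' {f g} hf hg h := by
    obtain ⟨c, hc⟩ := RatFunc.denom_add_dvd f g
    have := congrArg (Polynomial.eval a) hc
    rw [Polynomial.eval_mul, Polynomial.eval_mul, h, zero_mul] at this
    exact mul_ne_zero hf hg this
  zero_mem' := by simp
  neg_mem' {f} hf h := by
    obtain ⟨c, hc⟩ := RatFunc.denom_mul_dvd (-1) f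
    have h1 : (-1 : RatFunc ℂ).denom = 1 := by
      have : (-1 : RatFunc ℂ) = algebraMap ℂ[X] _ (-1) := by simp
      rw [this, RatFunc.denom_algebraMap]
    have := congrArg (Polynomial.eval a) hc
    rw [h1, one_mul, neg_one_mul, Polynomial.eval_mul, h, zero_mul] at this
    exact hf this

lemma mem_regularSubring {a : ℂ} {f : RatFunc ℂ} :
    f ∈ regularSubring a ↔ f.denom.eval a ≠ 0 := Iff.rfl

/-- Evaluation at `a` of the rational functions without pole at `a`. -/
def regularEval (a : ℂ) : regularSubring a →+* ℂ where
  toFun f := RatFunc.eval (RingHom.id ℂ) a f.1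
  map_one' := RatFunc.eval_one _ _
  map_zero' := RatFunc.eval_zero _ _
  map_mul' f g := RatFunc.eval_mul _ _ f.2 g.2
  map_add' f g := RatFunc.eval_add _ _ f.2 g.2

variable (a : ℂ)

/-- The Laurent expansion of rational functions at `a`. -/
def laurentExp : RatFunc ℂ →+* LaurentSeries ℂ :=
  (algebraMap (RatFunc ℂ) (LaurentSeries ℂ)).comp (RatFunc.laurent a).toRingHom

lemma laurentExp_apply (f : RatFunc ℂ) :
    laurentExp a f = algebraMap (RatFunc ℂ) (LaurentSeries ℂ) (RatFunc.laurent a f) := rfl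

lemma laurentExp_injective : Function.Injective (laurentExp a) := (laurentExp a).injective

lemma laurentExp_algebraMap (p : ℂ[X]) :
    laurentExp a (algebraMap ℂ[X] (RatFunc ℂ) p) =
      HahnSeries.ofPowerSeries ℤ ℂ ((Polynomial.taylor a p : ℂ[X]) : PowerSeries ℂ) := by
  rw [laurentExp_apply, RatFunc.laurent_algebraMap]
  rw [← RatFunc.coePolynomial_eq_algebraMap]
  exact (RatFunc.coe_coe _).symm

lemma laurentExp_C (c : ℂ) : laurentExp a (RatFunc.C c) = HahnSeries.C c := by
  rw [← RatFunc.algebraMap_C, laurentExp_algebraMap]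
  simp

lemma laurentExp_lin : laurentExp a (lin a) = HahnSeries.single 1 1 := by
  have : lin a = algebraMap ℂ[X] (RatFunc ℂ) (X - C a) := by simp [lin]
  rw [this, laurentExp_algebraMap]
  simp

lemma lin_ne_zero : lin a ≠ 0 := by
  intro h
  have := laurentExp_lin a
  rw [h, map_zero] at this
  simpa using congrArg (fun f => HahnSeries.coeff f 1) this

lemma lin_eq_algebraMap : lin a = algebraMap ℂ[X] (RatFunc ℂ) (X - C a) := by simp [lin]

lemma coeff_laurentExp_lin_pow_mul (l : ℕ) (f : RatFunc ℂ) (k : ℤ) :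
    (laurentExp a (lin a ^ l * f)).coeff k = (laurentExp a f).coeff (k - l) := by
  rw [map_mul, map_pow, laurentExp_lin, HahnSeries.single_pow, one_pow,
    HahnSeries.coeff_single_mul]
  simp

lemma coeff_laurentExp_mul_C (f : RatFunc ℂ) (c : ℂ) (k : ℤ) :
    (laurentExp a (f * RatFunc.C c)).coeff k = (laurentExp a f).coeff k * c := by
  rw [map_mul, laurentExp_C, HahnSeries.C_apply, HahnSeries.coeff_mul_single_zero]

lemma coeff_laurentExp_algebraMap (p : ℂ[X]) (k : ℕ) :
    (laurentExp a (algebraMap ℂ[X] (RatFunc ℂ) p)).coeff k = (Polynomial.taylor a p).coeff k := by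
  rw [laurentExp_algebraMap, HahnSeries.ofPowerSeries_apply_coeff, Polynomial.coeff_coe]

lemma coeff_ofPowerSeries_of_neg (p : PowerSeries ℂ) {k : ℤ} (hk : k < 0) :
    (HahnSeries.ofPowerSeries ℤ ℂ p).coeff k = 0 := by
  rw [PowerSeries.coeff_coe, if_pos hk]

lemma exists_ofPowerSeries_eq {f : LaurentSeries ℂ} (hf : ∀ k < 0, f.coeff k = 0) :
    ∃ p : PowerSeries ℂ, f = HahnSeries.ofPowerSeries ℤ ℂ p := by
  refine ⟨PowerSeries.mk fun k => f.coeff k, ?_⟩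
  ext k
  rw [PowerSeries.coeff_coe]
  split_ifs with hk
  · exact hf k hk
  · rw [PowerSeries.coeff_mk, Int.natAbs_of_nonneg (by omega)]

variable {a}

/-- The Taylor polynomial of the denominator has nonzero constant term, hence is invertible as a
power series. -/
lemma exists_laurentExp_eq {f : RatFunc ℂ} (hf : f ∈ regularSubring a) :
    ∃ p : PowerSeries ℂ, laurentExp a f = HahnSeries.ofPowerSeries ℤ ℂ p ∧
      PowerSeries.constantCoeff p = RatFunc.eval (RingHom.id ℂ) a f := by
  have hq : PowerSeries.constantCoeff ((Polynomial.taylor a f.denom : ℂ[X]) : PowerSeries ℂ) =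
      f.denom.eval a := by
    rw [Polynomial.constantCoeff_coe, Polynomial.taylor_coeff_zero]
  have hp : PowerSeries.constantCoeff ((Polynomial.taylor a f.num : ℂ[X]) : PowerSeries ℂ) =
      f.num.eval a := by
    rw [Polynomial.constantCoeff_coe, Polynomial.taylor_coeff_zero]
  have h1 : ((Polynomial.taylor a f.denom : ℂ[X]) : PowerSeries ℂ) *
      ((Polynomial.taylor a f.denom : ℂ[X]) : PowerSeries ℂ)⁻¹ = 1 :=
    PowerSeries.mul_inv_cancel _ (by rw [hq]; exact hf)
  refine ⟨((Polynomial.taylor a f.num : ℂ[X]) : PowerSeries ℂ) *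
    ((Polynomial.taylor a f.denom : ℂ[X]) : PowerSeries ℂ)⁻¹, ?_, ?_⟩
  · conv_lhs => rw [← RatFunc.num_div_denom f]
    rw [map_div₀, laurentExp_algebraMap, laurentExp_algebraMap, div_eq_iff, ← map_mul,
      mul_assoc, mul_comm _⁻¹, h1, mul_one]
    rw [← laurentExp_algebraMap, map_ne_zero_iff _ (laurentExp_injective a)]
    exact RatFunc.algebraMap_ne_zero f.denom_ne_zero
  · rw [map_mul, PowerSeries.constantCoeff_inv, hp, hq, RatFunc.eval, div_eq_mul_inv]
    rfl

lemma coeff_laurentExp_of_neg {f : RatFunc ℂ} (hf : f ∈ regularSubring a) {k : ℤ} (hk : k < 0) :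
    (laurentExp a f).coeff k = 0 := by
  obtain ⟨p, hp, -⟩ := exists_laurentExp_eq hf
  rw [hp, coeff_ofPowerSeries_of_neg p hk]

lemma coeff_zero_laurentExp {f : RatFunc ℂ} (hf : f ∈ regularSubring a) :
    (laurentExp a f).coeff 0 = RatFunc.eval (RingHom.id ℂ) a f := by
  obtain ⟨p, hp, h0⟩ := exists_laurentExp_eq hf
  rw [hp, ← h0, ← PowerSeries.coeff_zero_eq_constantCoeff_apply]
  exact HahnSeries.ofPowerSeries_apply_coeff p 0

/-- If the denominator vanished at a, comparing constant terms in denom · f = num would make the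
numerator vanish there too, against coprimality. -/
lemma mem_regularSubring_of_coeff {f : RatFunc ℂ} (hf : ∀ k < 0, (laurentExp a f).coeff k = 0) :
    f ∈ regularSubring a := by
  intro h
  obtain ⟨p, hp⟩ := exists_ofPowerSeries_eq hf
  have h1 : laurentExp a (algebraMap ℂ[X] _ f.denom) * laurentExp a f =
      laurentExp a (algebraMap ℂ[X] _ f.num) := by
    rw [← map_mul]
    congr 1
    rw [mul_comm]
    conv_lhs => enter [1]; rw [← RatFunc.num_div_denom f]
    exact div_mul_cancel₀ _ (RatFunc.algebraMap_ne_zero f.denom_ne_zero)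
  rw [hp, laurentExp_algebraMap, laurentExp_algebraMap, ← map_mul] at h1
  have h2 := congrArg PowerSeries.constantCoeff (HahnSeries.ofPowerSeries_injective h1)
  rw [map_mul, Polynomial.constantCoeff_coe, Polynomial.constantCoeff_coe,
    Polynomial.taylor_coeff_zero, Polynomial.taylor_coeff_zero, h, zero_mul] at h2
  obtain ⟨u, v, huv⟩ := f.isCoprime_num_denom
  have := congrArg (Polynomial.eval a) huv
  simp [← h2, h] at this

variable (a)

lemma algebraMap_mem_regularSubring (p : ℂ[X]) :
    algebraMap ℂ[X] (RatFunc ℂ) p ∈ regularSubring a := by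
  simp [mem_regularSubring]

lemma C_mem_regularSubring (c : ℂ) : RatFunc.C c ∈ regularSubring a := by
  simp [mem_regularSubring]

lemma lin_mem_regularSubring : lin a ∈ regularSubring a := by
  rw [lin_eq_algebraMap]; exact algebraMap_mem_regularSubring a _

lemma eval_lin : RatFunc.eval (RingHom.id ℂ) a (lin a) = 0 := by
  rw [lin_eq_algebraMap, RatFunc.eval, RatFunc.num_algebraMap]
  simp

/-- Stated for all large exponents so that one exponent can serve all entries of a matrix. -/
lemma exists_lin_pow_mul_mem (f : RatFunc ℂ) : ∃ c : ℕ, ∀ l ≥ c, lin a ^ l * f ∈ regularSubring a := by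
  refine ⟨(-(laurentExp a f).order).toNat, fun l hl => mem_regularSubring_of_coeff fun k hk => ?_⟩
  rw [coeff_laurentExp_lin_pow_mul]
  apply HahnSeries.coeff_eq_zero_of_lt_order
  omega

variable {a}

lemma isUnit_regularSubring {f : regularSubring a} (hf : regularEval a f ≠ 0) : IsUnit f := by
  have hf' : RatFunc.eval (RingHom.id ℂ) a f.1 ≠ 0 := hf
  have h0 : f.1 ≠ 0 := by
    rintro h; rw [h, RatFunc.eval_zero] at hf'; exact hf' rfl
  have hmem : (f.1)⁻¹ ∈ regularSubring a := by
    intro h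
    obtain ⟨c, hc⟩ := RatFunc.denom_inv_dvd h0
    have := congrArg (Polynomial.eval a) hc
    rw [Polynomial.eval_mul, h, zero_mul] at this
    apply hf'
    rw [RatFunc.eval, ← Polynomial.eval, this, zero_div]
  exact IsUnit.of_mul_eq_one ⟨_, hmem⟩ (Subtype.ext (mul_inv_cancel₀ h0))

/-- A rational function without pole at `a` is a polynomial if its product with some power of
`λ - a` is a polynomial. -/
lemma exists_algebraMap_eq_of_lin_pow_mul {f : RatFunc ℂ} (hf : f ∈ regularSubring a) {l : ℕ}
    {p : ℂ[X]} (h : lin a ^ l * f = algebraMap ℂ[X] _ p) : ∃ q, f = algebraMap ℂ[X] _ q := by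
  -- The reduced denominator is a power of X - a, and having no zero at a forces the exponent to be
  -- 0.
  have hdvd : f.denom ∣ (X - C a) ^ l := by
    rw [RatFunc.denom_dvd (pow_ne_zero _ (X_sub_C_ne_zero a))]
    refine ⟨p, ?_⟩
    rw [← h, map_pow, ← lin_eq_algebraMap, mul_div_cancel_left₀ _ (pow_ne_zero _ (lin_ne_zero a))]
  obtain ⟨i, hi, hass⟩ := (dvd_prime_pow (prime_X_sub_C a) l).1 hdvd
  have hmonic : f.denom = (X - C a) ^ i :=
    eq_of_monic_of_associated f.monic_denom ((monic_X_sub_C a).pow i) hass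
  have hi0 : i = 0 := by
    by_contra h0
    apply hf
    rw [hmonic]
    simp [h0]
  refine ⟨f.num, ?_⟩
  conv_lhs => rw [← RatFunc.num_div_denom f]
  rw [hmonic, hi0]
  simp

end LaurentExpansion


/-! ### Polynomial matrices as rational matrices. -/

section RationalMatrixLemmas

variable {μ ν κ : Type*}

lemma toRat_mul [Fintype ν] (P : Matrix μ ν ℂ[X]) (Q : Matrix ν κ ℂ[X]) :
    toRat (P * Q) = toRat P * toRat Q := Matrix.map_mul

lemma toRat_one [DecidableEq μ] : toRat (1 : Matrix μ μ ℂ[X]) = 1 := by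
  simp [toRat]

lemma toRat_injective : Function.Injective (toRat : Matrix μ ν ℂ[X] → _) :=
  Matrix.map_injective (RatFunc.algebraMap_injective ℂ)

lemma toRat_diagonal [DecidableEq μ] (d : μ → ℂ[X]) :
    toRat (Matrix.diagonal d) = Matrix.diagonal fun i => algebraMap ℂ[X] (RatFunc ℂ) (d i) := by
  rw [toRat, Matrix.diagonal_map (map_zero _)]

lemma isUnit_toRat [Fintype μ] [DecidableEq μ] {P : Matrix μ μ ℂ[X]} (h : IsUnit P) :
    IsUnit (toRat P) :=
  h.map (algebraMap ℂ[X] (RatFunc ℂ)).mapMatrix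

end RationalMatrixLemmas

/-! ### The diagonal factors, the unimodular transformation and the series P^{(i)}. -/

namespace ToeplitzRankSearch

variable {m n : ℕ} {A : ℕ → Matrix (Fin m) (Fin n) ℂ} (S : ToeplitzRankSearch A) (a : ℂ)

/-- The exponent of `λ - a` in the `j`-th diagonal entry of `Λ_0 ⋯ Λ_{t-1}`. -/
def expo (t : ℕ) (j : Fin n) : ℕ := ∑ i ∈ Finset.range t, if j.val < S.rho i then 0 else 1

lemma expo_succ (t : ℕ) (j : Fin n) :
    S.expo (t + 1) j = S.expo t j + if j.val < S.rho t then 0 else 1 :=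
  Finset.sum_range_succ _ _

lemma expo_of_last {t : ℕ} {j : Fin n} (h : S.rk t ≤ j.val) : S.expo t j = t := by
  rw [expo, Finset.sum_congr rfl (g := fun _ => 1)]
  · simp
  · intro i hi
    have : S.rk (i + 1) ≤ S.rk t := S.rk_mono (Finset.mem_range.1 hi)
    exact if_neg (not_lt.2 (this.trans h))

lemma expo_of_lt {i t : ℕ} {j : Fin n} (hit : i ≤ t) (h : j.val < S.rk (i + 1)) :
    S.expo t j = S.expo i j := by
  induction t, hit using Nat.le_induction with
  | base => rfl
  | succ t hit ih =>
    have := S.rk_mono (Nat.succ_le_succ hit)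
    rw [expo_succ, ih, if_pos, add_zero]
    exact lt_of_lt_of_le h this

/-- A column that enters the first block at step i receives one factor λ - a from each of Λ_0, …,
Λ_{i-1} and none afterwards. -/
lemma expo_of_block {i t : ℕ} {j : Fin n} (hit : i ≤ t) (h1 : S.rk i ≤ j.val)
    (h2 : j.val < S.rk (i + 1)) : S.expo t j = i := by
  rw [S.expo_of_lt hit h2, S.expo_of_last h1]

lemma expo_le (t : ℕ) (j : Fin n) : S.expo t j ≤ t := by
  rw [expo]
  refine (Finset.sum_le_sum (g := fun _ => 1) fun i _ => ?_).trans (by simp)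
  split_ifs <;> simp

lemma expo_mono (t : ℕ) {i j : Fin n} (h : i ≤ j) : S.expo t i ≤ S.expo t j := by
  refine Finset.sum_le_sum fun k _ => ?_
  have : i.val ≤ j.val := h
  split_ifs <;> omega

lemma lam_eq (i : ℕ) : S.Lam a i =
    Matrix.diagonal fun j => (X - C a) ^ (if j.val < S.rho i then 0 else 1) := by
  rw [Lam]
  congr 1
  ext1 j
  split_ifs <;> simp

lemma lamProd_succ (t : ℕ) : S.LamProd a (t + 1) = S.LamProd a t * S.Lam a t := by
  simp [LamProd, List.range_succ]

lemma lamProd_eq (t : ℕ) :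
    S.LamProd a t = Matrix.diagonal fun j => (X - C a) ^ S.expo t j := by
  induction t with
  | zero => simp [LamProd, expo]
  | succ t ih =>
    rw [lamProd_succ, ih, lam_eq, Matrix.diagonal_mul_diagonal]
    congr 1
    ext1 j
    rw [← pow_add, expo_succ]

lemma lamProd_comm (t : ℕ) : S.LamProd a t * S.Lam a t = S.Lam a t * S.LamProd a t := by
  rw [lamProd_eq, lam_eq, Matrix.diagonal_mul_diagonal, Matrix.diagonal_mul_diagonal]
  simp only [mul_comm]

lemma isIndexDiag (t : ℕ) : S.IsIndexDiag a t (S.LamProd a t) := by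
  refine ⟨?_, ?_, ?_⟩
  · intro i j hij
    rw [lamProd_eq, Matrix.diagonal_apply_ne _ hij]
  · intro i hi j h1 h2
    rw [lamProd_eq, Matrix.diagonal_apply_eq, S.expo_of_block hi.le h1 (by rwa [S.rk_succ])]
  · intro j hj
    rw [lamProd_eq, Matrix.diagonal_apply_eq, S.expo_of_last hj]

lemma toRat_lam (i : ℕ) : toRat (S.Lam a i) =
    Matrix.diagonal fun j => lin a ^ (if j.val < S.rho i then 0 else 1) := by
  simp only [lam_eq, toRat_diagonal, map_pow, lin_eq_algebraMap]

lemma toRat_lamProd (t : ℕ) : toRat (S.LamProd a t) =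
    Matrix.diagonal fun j => lin a ^ S.expo t j := by
  simp only [lamProd_eq, toRat_diagonal, map_pow, lin_eq_algebraMap]

lemma isUnit_det_toRat_lam (i : ℕ) : IsUnit (toRat (S.Lam a i)).det := by
  rw [toRat_lam, Matrix.det_diagonal]
  exact (Finset.prod_ne_zero_iff.2 fun j _ => pow_ne_zero _ (lin_ne_zero a)).isUnit

/-- The rational matrix `N_0 Λ_0⁻¹ ⋯ N_{t-1} Λ_{t-1}⁻¹`. -/
def stepProd (t : ℕ) : Matrix (Fin n) (Fin n) (RatFunc ℂ) :=
  ((List.range t).map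
    (fun i => (S.N i).map (RatFunc.C : ℂ →+* RatFunc ℂ) * (toRat (S.Lam a i))⁻¹)).prod

lemma transform_eq (t : ℕ) : S.transform a t = S.stepProd a t * toRat (S.LamProd a t) := rfl

lemma stepProd_zero : S.stepProd a 0 = 1 := rfl

lemma stepProd_succ (t : ℕ) : S.stepProd a (t + 1) =
    S.stepProd a t * ((S.N t).map (RatFunc.C : ℂ →+* RatFunc ℂ) * (toRat (S.Lam a t))⁻¹) := by
  simp [stepProd, List.range_succ]

lemma stepProd_succ_mul_lam (t : ℕ) : S.stepProd a (t + 1) * toRat (S.Lam a t) =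
    S.stepProd a t * (S.N t).map (RatFunc.C : ℂ →+* RatFunc ℂ) := by
  rw [stepProd_succ, Matrix.mul_assoc, Matrix.mul_assoc,
    Matrix.nonsing_inv_mul _ (S.isUnit_det_toRat_lam a t), Matrix.mul_one]

/-- Conjugation by Λ_0 ⋯ Λ_{t-1} multiplies entry (i, j) of N_t by λ - a to the power `expo t j -
expo t i`. A negative power needs j < ρ_{t-1}, where column j of N_t is a unit vector and the entry
is zero. The determinant is unchanged. -/
lemma exists_lamProd_conj (t : ℕ) : ∃ E : Matrix (Fin n) (Fin n) ℂ[X], IsUnit E ∧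
    S.LamProd a t * E = (S.N t).map C * S.LamProd a t := by
  let E : Matrix (Fin n) (Fin n) ℂ[X] := Matrix.of fun i j =>
    if S.expo t i ≤ S.expo t j then C (S.N t i j) * (X - C a) ^ (S.expo t j - S.expo t i) else 0
  have hE : S.LamProd a t * E = (S.N t).map C * S.LamProd a t := by
    ext1 i j
    rw [lamProd_eq, Matrix.diagonal_mul, Matrix.mul_diagonal, Matrix.map_apply]
    simp only [E, Matrix.of_apply]
    split_ifs with h
    · rw [mul_left_comm, ← pow_add, Nat.add_sub_cancel' h]
    · have hj : j.val < S.rk t := by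
        by_contra hj
        rw [S.expo_of_last (not_lt.1 hj)] at h
        exact h (S.expo_le t i)
      rw [(S.spec t).first_columns i j hj, if_neg (by rintro rfl; exact h le_rfl)]
      simp
  refine ⟨E, ?_, hE⟩
  have hdet := congrArg Matrix.det hE
  have h0 : (S.LamProd a t).det ≠ 0 := by
    rw [lamProd_eq, Matrix.det_diagonal]
    exact Finset.prod_ne_zero_iff.2 fun j _ => pow_ne_zero _ (X_sub_C_ne_zero a)
  rw [Matrix.det_mul, Matrix.det_mul, mul_comm] at hdet
  rw [Matrix.isUnit_iff_isUnit_det, mul_right_cancel₀ h0 hdet, ← RingHom.mapMatrix_apply,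
    ← RingHom.map_det]
  exact ((Matrix.isUnit_iff_isUnit_det _).1 (S.spec t).isUnit).map C

lemma toRat_map_C (N : Matrix (Fin n) (Fin n) ℂ) :
    toRat (N.map C) = N.map (RatFunc.C : ℂ →+* RatFunc ℂ) := by
  ext1 i j
  simp [toRat]

/-- Passing from t to t + 1 multiplies the transformation on the right by the matrix E of
`exists_lamProd_conj`, since Λ_t⁻¹ cancels against the new factor Λ_t. -/
lemma exists_polynomial_transform (t : ℕ) :
    ∃ N : Matrix (Fin n) (Fin n) ℂ[X], toRat N = S.transform a t ∧ IsUnit N := by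
  induction t with
  | zero =>
    refine ⟨1, ?_, isUnit_one⟩
    rw [transform_eq, stepProd_zero, lamProd_eq]
    simp [expo, toRat_one]
  | succ t ih =>
    obtain ⟨N, hN, hNu⟩ := ih
    obtain ⟨E, hEu, hE⟩ := S.exists_lamProd_conj a t
    refine ⟨N * E, ?_, hNu.mul hEu⟩
    rw [toRat_mul, hN, transform_eq, transform_eq, lamProd_succ, lamProd_comm, toRat_mul,
      ← Matrix.mul_assoc, stepProd_succ_mul_lam, Matrix.mul_assoc, ← toRat_mul, hE, toRat_mul,
      toRat_map_C, Matrix.mul_assoc]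

/-- Links the algebraic product to the search: division by Λ_i lowers the order of the last columns
by one, which is the shift of coefficients. -/
lemma coeff_stepProd {P : Matrix (Fin m) (Fin n) (RatFunc ℂ)}
    (hreg : ∀ p j, P p j ∈ regularSubring a)
    (hcoef : ∀ k : ℕ, laurentCoeff P a k = A k) (i : ℕ) :
    (∀ p j, (P * S.stepProd a i) p j ∈ regularSubring a) ∧
      ∀ k : ℕ, laurentCoeff (P * S.stepProd a i) a k = S.coef i k := by
  induction i with
  | zero =>
    rw [stepProd_zero, Matrix.mul_one, S.coef_zero]
    exact ⟨hreg, hcoef⟩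
  | succ i ih =>
    obtain ⟨ih1, ih2⟩ := ih
    set G := P * S.stepProd a i with hG
    set H := P * S.stepProd a (i + 1) with hH
    have hHG : ∀ p j, lin a ^ (if j.val < S.rho i then 0 else 1) * H p j =
        ∑ q, G p q * RatFunc.C (S.N i q j) := by
      intro p j
      have : H * toRat (S.Lam a i) = G * (S.N i).map (RatFunc.C : ℂ →+* RatFunc ℂ) := by
        rw [hH, hG, Matrix.mul_assoc, stepProd_succ_mul_lam, Matrix.mul_assoc]
      have := congrFun (congrFun this p) j
      rw [toRat_lam, Matrix.mul_diagonal, mul_comm] at this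
      simpa [Matrix.mul_apply] using this
    have hcoefG : ∀ p j (k : ℕ), (laurentExp a (∑ q, G p q * RatFunc.C (S.N i q j))).coeff k =
        (S.coef i k * S.N i) p j := by
      intro p j k
      rw [map_sum, HahnSeries.coeff_sum, Matrix.mul_apply, ← ih2 k]
      refine Finset.sum_congr rfl fun q _ => ?_
      rw [coeff_laurentExp_mul_C]
      rfl
    have hregG : ∀ p j, ∑ q, G p q * RatFunc.C (S.N i q j) ∈ regularSubring a := fun p j =>
      sum_mem fun q _ => mul_mem (ih1 p q) (C_mem_regularSubring a _)
    have hcoefH : ∀ p j (k : ℤ), (laurentExp a (H p j)).coeff k =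
        (laurentExp a (∑ q, G p q * RatFunc.C (S.N i q j))).coeff
          (k + (if j.val < S.rho i then 0 else 1 : ℕ)) := by
      intro p j k
      rw [← hHG, coeff_laurentExp_lin_pow_mul, add_sub_cancel_right]
    constructor
    · intro p j
      refine mem_regularSubring_of_coeff fun k hk => ?_
      rw [hcoefH]
      split_ifs with hj
      · exact coeff_laurentExp_of_neg (hregG p j) (by omega)
      -- The only dangerous coefficient is that of (λ - a)⁻¹. It is the constant coefficient before
      -- division, which the compression made zero.
      · rcases (show k + ((1 : ℕ) : ℤ) < 0 ∨ k + ((1 : ℕ) : ℤ) = ((0 : ℕ) : ℤ) by omega)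
          with h | h
        · exact coeff_laurentExp_of_neg (hregG p j) h
        · rw [h, hcoefG, S.coef_mul_N_eq_zero i p (not_lt.1 hj)]
    · intro k
      ext p j
      change (laurentExp a (H p j)).coeff k = _
      rw [hcoefH, ← Nat.cast_add, hcoefG]
      split_ifs with hj
      · rw [S.coef_succ_of_lt i k p hj, add_zero]
      · rw [S.coef_succ_of_le i k p (not_lt.1 hj)]

end ToeplitzRankSearch


/-! ### Matrices over the local ring at a. -/

section RegularMatrices

variable {μ ν κ : Type*} {a : ℂ}

/-- A matrix over the ring of rational functions without pole at `a` as a rational matrix. -/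
def regularToRat (G : Matrix μ ν (regularSubring a)) : Matrix μ ν (RatFunc ℂ) :=
  G.map (regularSubring a).subtype

lemma regularToRat_mul [Fintype ν] (G : Matrix μ ν (regularSubring a))
    (H : Matrix ν κ (regularSubring a)) :
    regularToRat (G * H) = regularToRat G * regularToRat H := Matrix.map_mul

lemma regularToRat_one [DecidableEq μ] :
    regularToRat (1 : Matrix μ μ (regularSubring a)) = 1 := by
  simp [regularToRat]

lemma regularToRat_injective :
    Function.Injective (regularToRat : Matrix μ ν (regularSubring a) → _) :=
  Matrix.map_injective Subtype.val_injective

lemma isRegularAt_regularToRat (G : Matrix μ ν (regularSubring a)) :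
    IsRegularAt (regularToRat G) a := fun i j => (G i j).2

lemma evalAt_regularToRat (G : Matrix μ ν (regularSubring a)) :
    evalAt (regularToRat G) a = G.map (regularEval a) := rfl

lemma IsRegularAt.exists_eq {G : Matrix μ ν (RatFunc ℂ)} (h : IsRegularAt G a) :
    ∃ G' : Matrix μ ν (regularSubring a), regularToRat G' = G :=
  ⟨Matrix.of fun i j => ⟨G i j, h i j⟩, rfl⟩

lemma isUnit_evalAt_regularToRat [Fintype μ] [DecidableEq μ] {G : Matrix μ μ (regularSubring a)}
    (h : IsUnit G) : IsUnit (evalAt (regularToRat G) a) :=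
  h.map (regularEval a).mapMatrix

lemma isUnit_of_isUnit_evalAt [Fintype μ] [DecidableEq μ] {G : Matrix μ μ (regularSubring a)}
    (h : IsUnit (evalAt (regularToRat G) a)) : IsUnit G := by
  rw [Matrix.isUnit_iff_isUnit_det]
  apply isUnit_regularSubring
  rw [RingHom.map_det]
  exact ((Matrix.isUnit_iff_isUnit_det _).1 h).ne_zero

/-- Polynomials as rational functions without pole at `a`. -/
def polyToRegular (a : ℂ) : ℂ[X] →+* regularSubring a :=
  (algebraMap ℂ[X] (RatFunc ℂ)).codRestrict _ (algebraMap_mem_regularSubring a)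

lemma regularToRat_map_polyToRegular (P : Matrix μ ν ℂ[X]) :
    regularToRat (P.map (polyToRegular a)) = toRat P := rfl

lemma isRegularAt_toRat (P : Matrix μ ν ℂ[X]) : IsRegularAt (toRat P) a :=
  isRegularAt_regularToRat (P.map (polyToRegular a))

lemma regularEval_polyToRegular (p : ℂ[X]) : regularEval a (polyToRegular a p) = p.eval a := by
  change RatFunc.eval (RingHom.id ℂ) a (algebraMap ℂ[X] (RatFunc ℂ) p) = _
  rw [RatFunc.eval, RatFunc.num_algebraMap, RatFunc.denom_algebraMap]
  simp

lemma evalAt_toRat (P : Matrix μ ν ℂ[X]) : evalAt (toRat P) a = P.map (Polynomial.eval a) := by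
  ext i j
  exact regularEval_polyToRegular (P i j)

lemma evalAt_mul [Fintype ν] {G : Matrix μ ν (RatFunc ℂ)} {H : Matrix ν κ (RatFunc ℂ)}
    (hG : IsRegularAt G a) (hH : IsRegularAt H a) :
    evalAt (G * H) a = evalAt G a * evalAt H a := by
  obtain ⟨G, rfl⟩ := hG.exists_eq
  obtain ⟨H, rfl⟩ := hH.exists_eq
  rw [← regularToRat_mul]
  simp only [evalAt_regularToRat]
  exact Matrix.map_mul

lemma evalAt_eq_laurentCoeff {G : Matrix μ ν (RatFunc ℂ)} (hG : IsRegularAt G a) :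
    evalAt G a = laurentCoeff G a 0 := by
  ext i j
  exact (coeff_zero_laurentExp (hG i j)).symm

lemma exists_lin_pow_smul_isRegularAt [Finite μ] [Finite ν] (G : Matrix μ ν (RatFunc ℂ)) :
    ∃ c : ℕ, IsRegularAt (lin a ^ c • G) a := by
  cases nonempty_fintype μ
  cases nonempty_fintype ν
  choose c hc using fun x : μ × ν => exists_lin_pow_mul_mem a (G x.1 x.2)
  exact ⟨Finset.univ.sup c, fun i j => hc (i, j) _ (Finset.le_sup (Finset.mem_univ (i, j)))⟩

end RegularMatrices

/-! ### Completion to invertible matrices and left inverses. -/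

section Completion

variable {m r : ℕ} {a : ℂ}

lemma exists_isUnit_firstCols {F : Type*} [Field F] (h : r ≤ m) {L : Matrix (Fin m) (Fin r) F}
    (hL : Function.Injective L.mulVec) :
    ∃ B : Matrix (Fin m) (Fin m) F, IsUnit B ∧ firstCols h B = L := by
  have hli : LinearIndependent F L.col := Matrix.mulVec_injective_iff.1 hL
  let b := Module.Basis.sumExtend hli
  have : Finite (Fin r ⊕ Module.Basis.sumExtendIndex hli) := Module.Finite.finite_basis b
  have : Finite (Module.Basis.sumExtendIndex hli) := Finite.sum_right (Fin r)
  cases nonempty_fintype (Module.Basis.sumExtendIndex hli)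
  have hcard := Module.finrank_eq_card_basis b
  rw [Module.finrank_fin_fun, Fintype.card_sum, Fintype.card_fin] at hcard
  let e : Module.Basis.sumExtendIndex hli ≃ Fin (m - r) := Fintype.equivFinOfCardEq (by omega)
  let b' := b.reindex (((Equiv.refl (Fin r)).sumCongr e).trans (splitEquiv h))
  refine ⟨(Pi.basisFun F (Fin m)).toMatrix b', ?_, ?_⟩
  · have := (Pi.basisFun F (Fin m)).invertibleToMatrix b'
    exact isUnit_of_invertible _
  · ext i j
    have : b' (splitEquiv h (Sum.inl j)) = L.col j := by
      simp only [b', b, Module.Basis.reindex_apply, Equiv.symm_trans_apply,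
        Equiv.symm_apply_apply, Module.Basis.sumExtend, Module.Basis.coe_extend]
      rfl
    simp [Module.Basis.toMatrix_apply, this]

/-- A matrix without pole at `a` whose value at `a` has independent columns can be brought to the
form `[I; 0]` by a row transformation that is invertible at `a`. -/
lemma exists_isUnit_mul_eq_firstCols_one (h : r ≤ m) (F : Matrix (Fin m) (Fin r) (regularSubring a))
    (hF : Function.Injective (evalAt (regularToRat F) a).mulVec) :
    ∃ M : Matrix (Fin m) (Fin m) (regularSubring a), IsUnit M ∧ M * F = firstCols h 1 := by
  obtain ⟨B, hB, hBF⟩ := exists_isUnit_firstCols h hF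
  -- F is completed by constant columns that complete F(a) to an invertible matrix. Then G(a) is
  -- invertible, so G is invertible over the local ring, and its inverse takes F to [I; 0].
  let G : Matrix (Fin m) (Fin m) (regularSubring a) :=
    joinCols h F ((lastCols h B).map fun z => polyToRegular a (C z))
  have hG : evalAt (regularToRat G) a = B := by
    rw [evalAt_regularToRat]
    ext i j
    rcases splitEquiv_cases h j with ⟨j, rfl, -⟩ | ⟨j, rfl, -⟩
    · rw [Matrix.map_apply, show G = joinCols h _ _ from rfl, joinCols_inl]
      exact (congrFun (congrFun hBF i) j).symm
    · rw [Matrix.map_apply, show G = joinCols h _ _ from rfl, joinCols_inr, Matrix.map_apply, regularEval_polyToRegular]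
      simp
  obtain ⟨M, hM⟩ := (isUnit_of_isUnit_evalAt (G := G) (by rwa [hG])).exists_left_inv
  refine ⟨M, IsUnit.of_mul_eq_one G hM, ?_⟩
  rw [← hM, ← mul_firstCols, firstCols_joinCols]

lemma exists_left_inverse_of_injective_evalAt (F : Matrix (Fin m) (Fin r) (regularSubring a))
    (hF : Function.Injective (evalAt (regularToRat F) a).mulVec) :
    ∃ Y : Matrix (Fin r) (Fin m) (regularSubring a), Y * F = 1 := by
  have h : r ≤ m := by
    have := (Matrix.mulVec_injective_iff_rank _).1 hF
    rw [Fintype.card_fin] at this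
    exact this ▸ Matrix.rank_le_height _
  obtain ⟨M, -, hM⟩ := exists_isUnit_mul_eq_firstCols_one h F hF
  refine ⟨M.submatrix (fun i => splitEquiv h (Sum.inl i)) id, ?_⟩
  ext1 i j
  have := congrFun (congrFun hM (splitEquiv h (Sum.inl i))) j
  rw [firstCols_apply] at this
  simpa [Matrix.mul_apply, Matrix.one_apply] using this

lemma rank_regularToRat_of_injective_evalAt (F : Matrix (Fin m) (Fin r) (regularSubring a))
    (hF : Function.Injective (evalAt (regularToRat F) a).mulVec) :
    (regularToRat F).rank = r := by
  obtain ⟨Y, hY⟩ := exists_left_inverse_of_injective_evalAt F hF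
  have := congrArg regularToRat hY
  rw [regularToRat_mul, regularToRat_one] at this
  rw [(Matrix.mulVec_injective_iff_rank _).1 (Matrix.mulVec_injective_of_mul_eq_one this),
    Fintype.card_fin]

/-- A matrix of rank `r` has an invertible `r × r` compression. -/
lemma Matrix.exists_mul_mul_eq_one {F : Type*} [Field F] {n : ℕ} {P : Matrix (Fin m) (Fin n) F}
    (hP : P.rank = r) :
    ∃ (Y : Matrix (Fin r) (Fin m) F) (X : Matrix (Fin n) (Fin r) F), Y * P * X = 1 := by
  let b := Module.finBasisOfFinrankEq F (LinearMap.range P.mulVecLin) hP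
  choose x hx using fun j => (b j).2
  have hinj : Function.Injective (P * (Matrix.of x).transpose).mulVec := by
    rw [Matrix.mulVec_injective_iff]
    have : (P * (Matrix.of x).transpose).col = fun j => (b j : Fin m → F) := by
      ext j i
      rw [← hx j]
      rfl
    rw [this]
    have hb : LinearIndependent F ((LinearMap.range P.mulVecLin).subtype ∘ b) :=
      b.linearIndependent.map' _ (Submodule.ker_subtype _)
    exact hb
  obtain ⟨Y, hY⟩ := Matrix.exists_mul_eq_one_of_mulVec_injective hinj
  exact ⟨Y, (Matrix.of x).transpose, by rw [Matrix.mul_assoc]; exact hY⟩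

/-- If the columns of `F` are columns of a matrix of the same rank, then `F` times a left inverse
fixes that matrix. -/
lemma Matrix.mul_mul_eq_of_rank_eq {F : Type*} [Field F] {n : ℕ} (h : r ≤ n)
    {G : Matrix (Fin m) (Fin n) F} (hG : G.rank = r) {Y : Matrix (Fin r) (Fin m) F}
    (hY : Y * firstCols h G = 1) : firstCols h G * (Y * G) = G := by
  have hle : LinearMap.range (firstCols h G).mulVecLin ≤ LinearMap.range G.mulVecLin := by
    have : firstCols h G = G * firstCols h (1 : Matrix (Fin n) (Fin n) F) := by
      rw [mul_firstCols, Matrix.mul_one]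
    rw [this, Matrix.mulVecLin_mul]
    exact LinearMap.range_comp_le_range _ _
  have hrank : (firstCols h G).rank = r := by
    rw [(Matrix.mulVec_injective_iff_rank _).1 (Matrix.mulVec_injective_of_mul_eq_one hY),
      Fintype.card_fin]
  have heq := Submodule.eq_of_le_of_finrank_eq hle (by
    change (firstCols h G).rank = G.rank
    rw [hrank, hG])
  apply Matrix.mulVec_injective
  ext1 v
  have hv : G.mulVec v ∈ LinearMap.range (firstCols h G).mulVecLin := by
    rw [heq]; exact ⟨v, rfl⟩
  obtain ⟨w, hw⟩ := hv
  rw [Matrix.mulVecLin_apply] at hw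
  rw [← Matrix.mulVec_mulVec, ← Matrix.mulVec_mulVec, ← hw,
    Matrix.mulVec_mulVec (M := Y), hY, Matrix.one_mulVec]

end Completion

/-! ### Divisibility of minors. -/

section RankDrop

variable {D : Type*} [CommRing D] [IsDomain D] {n r : ℕ}

/-- If the diagonal matrix `Λ` has fewer than `r` entries that are not divisible by `τ`, then the
determinant of every `r × r` matrix `U Λ V` is divisible by `τ`. -/
lemma dvd_det_mul_diagonal_mul (U : Matrix (Fin r) (Fin n) D) (V : Matrix (Fin n) (Fin r) D)
    (w : Fin n → D) (τ : D) {s : ℕ} (hs : s < r) (hw : ∀ j : Fin n, s ≤ j.val → τ ∣ w j) :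
    τ ∣ (U * Matrix.diagonal w * V).det := by
  classical
  -- Setting the divisible entries to zero does not change the determinant modulo τ, and leaves a
  -- product of rank at most s < r.
  let w' : Fin n → D := fun j => if j.val < s then w j else 0
  have h0 : (U * Matrix.diagonal w' * V).det = 0 := by
    by_contra h
    have h1 := Matrix.rank_of_det_ne_zero h
    have h2 := (Matrix.rank_mul_le_left (U * Matrix.diagonal w') V).trans
      (Matrix.rank_mul_le_right U (Matrix.diagonal w'))
    have h3 : (Matrix.diagonal w').rank ≤ s := by
      let T : Finset (Fin n) := Finset.univ.filter fun j => j.val < s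
      have hT : T.card ≤ s := by
        have := Finset.card_le_card_of_injOn (s := T) (t := Finset.range s) Fin.val
          (by intro j hj; simpa [T] using hj) (Fin.val_injective.injOn)
        simpa using this
      refine le_trans (Matrix.rank_le_card_of_support_subset _ (s := T) ?_) hT
      intro i hi
      simp only [T, Finset.coe_filter, Finset.mem_univ, true_and, Set.mem_ofPred_eq]
      by_contra hlt
      apply hi
      ext j
      rcases eq_or_ne i j with rfl | hij
      · simp [w', hlt]
      · simp [hij]
    rw [Fintype.card_fin] at h1
    omega
  rw [← Ideal.mem_span_singleton, ← Ideal.Quotient.eq_zero_iff_mem, RingHom.map_det]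
  have hmap : (Ideal.Quotient.mk (Ideal.span {τ})).mapMatrix (U * Matrix.diagonal w * V) =
      (Ideal.Quotient.mk (Ideal.span {τ})).mapMatrix (U * Matrix.diagonal w' * V) := by
    simp only [RingHom.mapMatrix_apply, Matrix.map_mul, Matrix.diagonal_map (map_zero _)]
    congr 3
    ext1 j
    rcases lt_or_ge j.val s with hj | hj
    · simp [w', hj]
    · simpa [w', not_lt.2 hj, Ideal.Quotient.eq_zero_iff_mem, Ideal.mem_span_singleton]
        using hw j hj
  rw [hmap, ← RingHom.map_det, h0, map_zero]

end RankDrop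


/-! ### Column reduction to local Smith form. -/

section LocalForm

variable {m n r : ℕ} {D : Type*} [CommRing D]

lemma firstCols_mul_diagonal {s : ℕ} (h : s ≤ n)
    (G : Matrix (Fin m) (Fin n) D) (w : Fin n → D) :
    firstCols h (G * Matrix.diagonal w) =
      firstCols h G * Matrix.diagonal fun j => w (splitEquiv h (Sum.inl j)) := by
  ext i j
  simp [Matrix.mul_diagonal]

/-- Column reduction of `V diag(τ^w)` for `V = [I, *]`, when no exponent in the second block is
smaller than one in the first block. -/
lemma exists_isUnit_mul_diagonal_mul (hn : r ≤ n) {V : Matrix (Fin r) (Fin n) D}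
    (hV : firstCols hn V = 1) (τ : D) (w : Fin n → ℕ)
    (hw : ∀ i j, w (splitEquiv hn (Sum.inl i)) ≤ w (splitEquiv hn (Sum.inr j))) :
    ∃ K : Matrix (Fin n) (Fin n) D, IsUnit K ∧
      V * Matrix.diagonal (fun j => τ ^ w j) * K =
        joinCols hn (Matrix.diagonal fun j => τ ^ w (splitEquiv hn (Sum.inl j))) 0 := by
  -- H solves diag(τ^w) H = (second block of V) diag(τ^w), with the first and second parts of w
  -- respectively; by `hw` the natural subtraction is exact.
  let H : Matrix (Fin r) (Fin (n - r)) D := Matrix.of fun i j =>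
    V i (splitEquiv hn (Sum.inr j)) *
      τ ^ (w (splitEquiv hn (Sum.inr j)) - w (splitEquiv hn (Sum.inl i)))
  let K : Matrix (Fin n) (Fin n) D :=
    Matrix.reindex (splitEquiv hn) (splitEquiv hn) (Matrix.fromBlocks 1 (-H) 0 1)
  have hVa : ∀ i j, V i (splitEquiv hn (Sum.inl j)) = if i = j then 1 else 0 := fun i j =>
    (congrFun (congrFun hV i) j).trans Matrix.one_apply
  refine ⟨K, ?_, ?_⟩
  · rw [Matrix.isUnit_iff_isUnit_det, Matrix.det_reindex_self, Matrix.det_fromBlocks_zero₂₁]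
    simp
  · ext1 i j
    rw [Matrix.mul_apply, sum_splitEquiv hn]
    rcases splitEquiv_cases hn j with ⟨j, rfl, -⟩ | ⟨j, rfl, -⟩
    · simp only [K, hVa, joinCols_inl, Matrix.mul_diagonal, Matrix.diagonal_apply,
        Matrix.reindex_apply, Matrix.submatrix_apply, Equiv.symm_apply_apply,
        Matrix.fromBlocks_apply₁₁, Matrix.fromBlocks_apply₂₁, Matrix.one_apply, Matrix.zero_apply,
        mul_ite, mul_one, mul_zero, ite_mul, one_mul, zero_mul, Finset.sum_ite_eq',
        Finset.mem_univ, if_true, Finset.sum_const_zero, add_zero]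
      split_ifs with hij
      · rw [hij]
      · rfl
    · rw [joinCols_inr]
      simp only [K, H, hVa, Matrix.mul_diagonal, Matrix.reindex_apply, Matrix.submatrix_apply,
        Equiv.symm_apply_apply, Matrix.fromBlocks_apply₁₂, Matrix.fromBlocks_apply₂₂,
        Matrix.one_apply, Matrix.zero_apply, Matrix.neg_apply, Matrix.of_apply, mul_ite, mul_one,
        mul_zero, ite_mul, one_mul, zero_mul, mul_neg, Finset.sum_neg_distrib, Finset.sum_ite_eq, Finset.sum_ite_eq',
        Finset.mem_univ, if_true]
      rw [mul_left_comm, ← pow_add, Nat.add_sub_cancel' (hw i j), neg_add_cancel]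

end LocalForm

/-! ### Termination of the search and the structural indices. -/

namespace ToeplitzRankSearch

variable {m n : ℕ} {A : ℕ → Matrix (Fin m) (Fin n) ℂ} (S : ToeplitzRankSearch A) {a : ℂ}
  {P : Matrix (Fin m) (Fin n) (RatFunc ℂ)}

lemma isRegularAt_mul_stepProd (hreg : IsRegularAt P a)
    (hcoef : ∀ k : ℕ, laurentCoeff P a k = A k) (i : ℕ) : IsRegularAt (P * S.stepProd a i) a :=
  (S.coeff_stepProd a hreg hcoef i).1

lemma evalAt_mul_stepProd (hreg : IsRegularAt P a)
    (hcoef : ∀ k : ℕ, laurentCoeff P a k = A k) (i : ℕ) :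
    evalAt (P * S.stepProd a i) a = S.coef i 0 := by
  obtain ⟨h1, h2⟩ := S.coeff_stepProd a hreg hcoef i
  rw [evalAt_eq_laurentCoeff h1, ← h2 0]
  rfl

lemma isUnit_det_stepProd (t : ℕ) : IsUnit (S.stepProd a t).det := by
  obtain ⟨N, hN, hNu⟩ := S.exists_polynomial_transform a t
  have h := (Matrix.isUnit_iff_isUnit_det _).1 (isUnit_toRat hNu)
  rw [hN, transform_eq, Matrix.det_mul] at h
  exact isUnit_of_mul_isUnit_left h

lemma rank_mul_stepProd (t : ℕ) : (P * S.stepProd a t).rank = P.rank :=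
  Matrix.rank_mul_eq_left_of_isUnit_det _ _ (S.isUnit_det_stepProd t)

lemma firstCols_coef_succ (i : ℕ) : firstCols (S.rho_le i) (S.coef (i + 1) 0) = S.L0 i := by
  rw [S.shift i 0]
  exact firstCols_joinCols (S.rho_le i) _ _

/-- Columns independent at a are independent over the rational functions, and the values at a of the
first ρ_i columns of P^{(i)} form `L0 i`. -/
lemma rho_le_rank (hreg : IsRegularAt P a) (hcoef : ∀ k : ℕ, laurentCoeff P a k = A k) (i : ℕ) :
    S.rho i ≤ P.rank := by
  have hG := S.isRegularAt_mul_stepProd hreg hcoef (i + 1)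
  obtain ⟨G, hG'⟩ := hG.exists_eq
  have hF := rank_regularToRat_of_injective_evalAt (firstCols (S.rho_le i) G) (by
    have : evalAt (regularToRat (firstCols (S.rho_le i) G)) a =
        firstCols (S.rho_le i) (evalAt (regularToRat G) a) := rfl
    rw [this, hG', S.evalAt_mul_stepProd hreg hcoef, firstCols_coef_succ]
    exact S.L0_injective i)
  have h1 : regularToRat (firstCols (S.rho_le i) G) =
      (P * S.stepProd a (i + 1)) * firstCols (S.rho_le i) (1 : Matrix (Fin n) (Fin n) (RatFunc ℂ)) := by
    rw [← hG', mul_firstCols, Matrix.mul_one]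
    rfl
  rw [← hF, h1, ← S.rank_mul_stepProd (a := a) (P := P) (i + 1)]
  exact Matrix.rank_mul_le_left _ _

lemma exists_rho_eq_rank (hreg : IsRegularAt P a)
    (hcoef : ∀ k : ℕ, laurentCoeff P a k = A k) : ∃ k, S.rho k = P.rank := by
  by_contra! hne
  have hlt : ∀ k, S.rho k < P.rank := fun k =>
    lt_of_le_of_ne (S.rho_le_rank hreg hcoef k) (hne k)
  set r := P.rank with hr
  -- Y P X = I certifies the rank. Clearing the poles of Y and X at a turns I into (λ - a)^(c+b) I,
  -- of determinant (λ - a)^((c+b)r).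
  obtain ⟨Y, X, hYX⟩ := Matrix.exists_mul_mul_eq_one hr.symm
  obtain ⟨c, hY⟩ := exists_lin_pow_smul_isRegularAt (a := a) Y
  obtain ⟨b, hX⟩ := exists_lin_pow_smul_isRegularAt (a := a) X
  obtain ⟨Y', hY'⟩ := hY.exists_eq
  obtain ⟨X', hX'⟩ := hX.exists_eq
  let τ : regularSubring a := ⟨lin a, lin_mem_regularSubring a⟩
  have hτ : regularEval a τ = 0 := eval_lin a
  have hτ0 : τ ≠ 0 := fun h => lin_ne_zero a (congrArg Subtype.val h)
  -- One more than the order at a of that determinant, so divisibility by τ^t is impossible.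
  set t := (c + b) * r + 1 with ht
  obtain ⟨G, hG⟩ := (S.isRegularAt_mul_stepProd hreg hcoef t).exists_eq
  obtain ⟨N, hN, hNu⟩ := S.exists_polynomial_transform a t
  obtain ⟨N', hN'⟩ := hNu.exists_right_inv
  have hmain : Y' * G * Matrix.diagonal (fun j => τ ^ S.expo t j) *
      (N'.map (polyToRegular a) * X') = τ ^ (c + b) • 1 := by
    apply regularToRat_injective
    have h1 : regularToRat (Matrix.diagonal fun j => τ ^ S.expo t j) =
        toRat (S.LamProd a t) := by
      rw [toRat_lamProd, regularToRat, Matrix.diagonal_map (map_zero _)]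
      rfl
    have h2 : regularToRat (τ ^ (c + b) • (1 : Matrix (Fin r) (Fin r) (regularSubring a))) =
        lin a ^ (c + b) • 1 := by
      rw [← regularToRat_one (a := a)]
      rfl
    rw [h2]
    simp only [regularToRat_mul]
    rw [h1, hG, hY', hX', regularToRat_map_polyToRegular]
    calc lin a ^ c • Y * (P * S.stepProd a t) * toRat (S.LamProd a t) *
          (toRat N' * lin a ^ b • X)
        = lin a ^ c • lin a ^ b •
          (Y * P * (S.stepProd a t * toRat (S.LamProd a t) * toRat N') * X) := by
          simp only [Matrix.smul_mul, Matrix.mul_smul, Matrix.mul_assoc]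
          exact smul_comm _ _ _
      _ = lin a ^ (c + b) • 1 := by
          rw [← transform_eq, ← hN, ← toRat_mul, hN', toRat_one, Matrix.mul_one, hYX, smul_smul,
            pow_add]
  -- Since `S.rk t` is ρ_{t-1}, the bound needed is `hlt` at t - 1 = (c + b) * r.
  have hdvd := dvd_det_mul_diagonal_mul (Y' * G) (N'.map (polyToRegular a) * X')
    (fun j => τ ^ S.expo t j) (τ ^ t) (s := S.rk t) (hlt ((c + b) * r)) (fun j hj => by
      rw [S.expo_of_last hj])
  rw [hmain, Matrix.det_smul, Matrix.det_one, mul_one, Fintype.card_fin, ← pow_mul] at hdvd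
  obtain ⟨z, hz⟩ := hdvd
  rw [ht, pow_succ, mul_assoc] at hz
  have := mul_left_cancel₀ (pow_ne_zero _ hτ0) ((mul_one _).trans hz)
  have := congrArg (regularEval a) this
  rw [map_one, map_mul, hτ, zero_mul] at this
  exact one_ne_zero this

lemma exists_isLeast_rank (hreg : IsRegularAt P a)
    (hcoef : ∀ k : ℕ, laurentCoeff P a k = A k) : ∃ d, IsLeast {k | S.rho k = P.rank} d := by
  classical
  have h := S.exists_rho_eq_rank hreg hcoef
  exact ⟨Nat.find h, Nat.find_spec h, fun k hk => Nat.find_min' h hk⟩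

lemma rank_coef_succ (hreg : IsRegularAt P a) (hcoef : ∀ k : ℕ, laurentCoeff P a k = A k) {d : ℕ}
    (hd : S.rho d = P.rank) : (S.coef (d + 1) 0).rank = P.rank := by
  rw [rank_coef_zero]
  refine le_antisymm (S.rho_le_rank hreg hcoef _) ?_
  rw [← hd]
  exact S.rk_mono (Nat.le_succ _)

/-- With G = P^{(d)}, F its first r columns and V = YG = [I, *], the rank condition gives G = FV.
Hence M (λ - a)^l R N K = (MF)(V Λ K) = [I; 0][Λ_r, 0], where M, N and K are invertible over the
local ring. -/
lemma isStructuralIndices {R : Matrix (Fin m) (Fin n) (RatFunc ℂ)} {l : ℕ}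
    (hreg : IsRegularAt (lin a ^ l • R) a)
    (hcoef : ∀ k : ℕ, laurentCoeff (lin a ^ l • R) a k = A k) {d : ℕ} (hd : S.rho d = R.rank) :
    IsStructuralIndices R a fun j : Fin (S.rho d) =>
      (S.expo (d + 1) (splitEquiv (S.rho_le d) (Sum.inl j)) : ℤ) - l := by
  have hl0 : lin a ^ l ≠ 0 := pow_ne_zero _ (lin_ne_zero a)
  refine ⟨hd.symm, ?_, ?_⟩
  · intro i j hij
    have : S.expo (d + 1) (splitEquiv (S.rho_le d) (Sum.inl i)) ≤
        S.expo (d + 1) (splitEquiv (S.rho_le d) (Sum.inl j)) :=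
      S.expo_mono _ (by rwa [Fin.le_def, splitEquiv_inl_val, splitEquiv_inl_val])
    simpa using this
  have hn := S.rho_le d
  have hm : S.rho d ≤ m := hd ▸ Matrix.rank_le_height R
  have hrank : (lin a ^ l • R).rank = S.rho d := by
    rw [hd, Matrix.rank_smul_of_mem_nonZeroDivisors _ (mem_nonZeroDivisors_of_ne_zero hl0)]
  have hGrank := (S.rank_mul_stepProd (a := a) (P := lin a ^ l • R) (d + 1)).trans hrank
  obtain ⟨G, hG⟩ := (S.isRegularAt_mul_stepProd hreg hcoef (d + 1)).exists_eq
  have hinj : Function.Injective (evalAt (regularToRat (firstCols hn G)) a).mulVec := by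
    have : evalAt (regularToRat (firstCols hn G)) a =
        firstCols hn (evalAt (regularToRat G) a) := rfl
    rw [this, hG, S.evalAt_mul_stepProd hreg hcoef, firstCols_coef_succ]
    exact S.L0_injective d
  obtain ⟨M, hM, hMF⟩ := exists_isUnit_mul_eq_firstCols_one hm (firstCols hn G) hinj
  obtain ⟨Y, hY⟩ := exists_left_inverse_of_injective_evalAt (firstCols hn G) hinj
  have hFG : firstCols hn G * (Y * G) = G := by
    apply regularToRat_injective
    rw [← hG] at hGrank
    rw [regularToRat_mul, regularToRat_mul]
    have hY' := congrArg regularToRat hY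
    rw [regularToRat_mul, regularToRat_one] at hY'
    exact Matrix.mul_mul_eq_of_rank_eq hn hGrank hY'
  let τ : regularSubring a := ⟨lin a, lin_mem_regularSubring a⟩
  obtain ⟨K, hK, hVK⟩ := exists_isUnit_mul_diagonal_mul hn (V := Y * G)
    (by rw [← mul_firstCols, hY]) τ (S.expo (d + 1)) (fun i j => by
      -- The discarded columns have exponent d + 1, the maximum, so no negative power of τ is
      -- needed.
      rw [S.expo_of_last (t := d + 1) (j := splitEquiv hn (Sum.inr j))]
      · exact S.expo_le _ _
      · rw [splitEquiv_inr_val]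
        exact Nat.le_add_right _ _)
  obtain ⟨N, hN, hNu⟩ := S.exists_polynomial_transform a (d + 1)
  have hNK : IsUnit (N.map (polyToRegular a) * K) := (hNu.map (polyToRegular a).mapMatrix).mul hK
  refine ⟨regularToRat M, regularToRat (N.map (polyToRegular a) * K), isRegularAt_regularToRat _,
    isRegularAt_regularToRat _, isUnit_evalAt_regularToRat hM, isUnit_evalAt_regularToRat hNK, ?_⟩
  have h1 : regularToRat (Matrix.diagonal fun j => τ ^ S.expo (d + 1) j) =
      toRat (S.LamProd a (d + 1)) := by
    rw [toRat_lamProd, regularToRat, Matrix.diagonal_map (map_zero _)]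
    rfl
  have h2 : lin a ^ l • (regularToRat M * R * regularToRat (N.map (polyToRegular a) * K)) =
      regularToRat (M * G * Matrix.diagonal (fun j => τ ^ S.expo (d + 1) j) * K) := by
    simp only [regularToRat_mul]
    rw [h1, hG, regularToRat_map_polyToRegular, hN, transform_eq]
    simp only [Matrix.smul_mul, Matrix.mul_smul, Matrix.mul_assoc]
  have h3 : M * G * Matrix.diagonal (fun j => τ ^ S.expo (d + 1) j) * K =
      firstCols hm (1 : Matrix (Fin m) (Fin m) (regularSubring a)) * joinCols hn
        (Matrix.diagonal fun j => τ ^ S.expo (d + 1) (splitEquiv hn (Sum.inl j))) 0 := by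
    rw [← hVK, ← hMF]
    conv_lhs => rw [← hFG]
    simp only [Matrix.mul_assoc]
  rw [h3] at h2
  ext1 i j
  have h4 := congrFun (congrFun h2 i) j
  rw [Matrix.smul_apply, smul_eq_mul] at h4
  apply mul_left_cancel₀ hl0
  rw [h4]
  simp only [regularToRat, Matrix.map_apply, localSmithMatrix, Matrix.of_apply, Matrix.mul_apply]
  rcases splitEquiv_cases hm i with ⟨i, rfl, -⟩ | ⟨i, rfl, -⟩
  · rcases splitEquiv_cases hn j with ⟨j, rfl, hj⟩ | ⟨j, rfl, hj⟩
    · simp only [joinCols_inl, firstCols_apply, Matrix.one_apply, Matrix.diagonal_apply,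
        EmbeddingLike.apply_eq_iff_eq, Sum.inl.injEq, ite_mul, one_mul, zero_mul,
        Finset.sum_ite_eq, Finset.mem_univ, if_true, splitEquiv_inl_val, Fin.is_lt, and_true,
        ← Fin.ext_iff]
      split_ifs with hij
      · subst hij
        rw [zpow_sub₀ (lin_ne_zero a), zpow_natCast, zpow_natCast, mul_div_cancel₀ _ hl0]
        rfl
      · simp
    · rw [dif_neg (by simp; have := i.2; omega)]
      simp
  · rw [dif_neg (by simp)]
    simp

end ToeplitzRankSearch


/-! ### Values at a and the compact local forms. -/

namespace ToeplitzRankSearch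

variable {m n : ℕ} {A : ℕ → Matrix (Fin m) (Fin n) ℂ} (S : ToeplitzRankSearch A) {a : ℂ}
  {P : Matrix (Fin m) (Fin n) (RatFunc ℂ)} {d : ℕ}

lemma mul_transform (t : ℕ) :
    P * S.transform a t = P * S.stepProd a t * toRat (S.LamProd a t) := by
  rw [transform_eq, Matrix.mul_assoc]

lemma firstCols_evalAt_mul_stepProd (hreg : IsRegularAt P a)
    (hcoef : ∀ k : ℕ, laurentCoeff P a k = A k) (d : ℕ) :
    firstCols (S.rho_le d) (evalAt (P * S.stepProd a (d + 1)) a) = S.L0 d := by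
  rw [S.evalAt_mul_stepProd hreg hcoef, firstCols_coef_succ]

lemma rank_evalAt_mul_stepProd (hreg : IsRegularAt P a)
    (hcoef : ∀ k : ℕ, laurentCoeff P a k = A k) (hd : S.rho d = P.rank) :
    (evalAt (P * S.stepProd a (d + 1)) a).rank = P.rank := by
  rw [S.evalAt_mul_stepProd hreg hcoef, S.rank_coef_succ hreg hcoef hd]

/-- Λ_d(a) = diag(I, 0) keeps the first ρ_d columns and annihilates the others. -/
lemma evalAt_mul_stepProd_mul_lam (hreg : IsRegularAt P a)
    (hcoef : ∀ k : ℕ, laurentCoeff P a k = A k) (d : ℕ) :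
    evalAt (P * S.stepProd a (d + 1) * toRat (S.Lam a d)) a =
      joinCols (S.rho_le d) (S.L0 d) 0 := by
  have h : (S.Lam a d).map (Polynomial.eval a) =
      Matrix.diagonal fun j : Fin n => if j.val < S.rho d then (1 : ℂ) else 0 := by
    rw [Lam, Matrix.diagonal_map (Polynomial.eval_zero)]
    congr 1
    ext1 j
    split_ifs <;> simp
  rw [evalAt_mul (S.isRegularAt_mul_stepProd hreg hcoef _) (isRegularAt_toRat _), evalAt_toRat, h,
    ← S.firstCols_evalAt_mul_stepProd hreg hcoef d]
  ext i j
  rw [Matrix.mul_diagonal]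
  rcases splitEquiv_cases (S.rho_le d) j with ⟨j, rfl, -⟩ | ⟨j, rfl, -⟩
  · rw [joinCols_inl]
    simp
  · rw [joinCols_inr]
    simp

lemma rank_joinCols_L0 (d : ℕ) : (joinCols (S.rho_le d) (S.L0 d) 0).rank = S.rho d := by
  rw [Matrix.rank_joinCols_zero, rank_L0]

lemma finrank_ker_joinCols_L0 (d : ℕ) :
    Module.finrank ℂ (LinearMap.ker (joinCols (S.rho_le d) (S.L0 d) 0).mulVecLin) =
      n - S.rho d := by
  have h := (joinCols (S.rho_le d) (S.L0 d) 0).mulVecLin.finrank_range_add_finrank_ker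
  have h' := S.rank_joinCols_L0 d
  rw [Matrix.rank] at h'
  rw [h', Module.finrank_fin_fun] at h
  omega

lemma expo_inl_of_block {i : ℕ} (hi : i ≤ d) {j : Fin (S.rho d)} (h1 : S.rk i ≤ j.val)
    (h2 : j.val < S.rk i + S.e i) :
    S.expo (d + 1) (splitEquiv (S.rho_le d) (Sum.inl j)) = i :=
  S.expo_of_block (Nat.le_succ_of_le hi) (by rwa [splitEquiv_inl_val])
    (by rwa [splitEquiv_inl_val, S.rk_succ])

lemma exists_firstCols_left_inverse {N : Matrix (Fin n) (Fin n) ℂ[X]} (hN : IsUnit N) {r : ℕ}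
    (h : r ≤ n) : ∃ Y : Matrix (Fin r) (Fin n) ℂ[X], Y * firstCols h N = 1 := by
  obtain ⟨M, hM⟩ := hN.exists_left_inv
  refine ⟨M.submatrix (fun i => splitEquiv h (Sum.inl i)) id, ?_⟩
  ext1 i j
  have := congrFun (congrFun hM (splitEquiv h (Sum.inl i))) (splitEquiv h (Sum.inl j))
  simpa [Matrix.mul_apply, Matrix.one_apply] using this

lemma isCompactLocalSmithMcMillan {R : Matrix (Fin m) (Fin n) (RatFunc ℂ)} {l : ℕ}
    (hreg : IsRegularAt (lin a ^ l • R) a)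
    (hcoef : ∀ k : ℕ, laurentCoeff (lin a ^ l • R) a k = A k) (hd : S.rho d = R.rank)
    {N : Matrix (Fin n) (Fin n) ℂ[X]} (hN : toRat N = S.transform a (d + 1)) (hNu : IsUnit N) :
    IsCompactLocalSmithMcMillan R a
      (fun j => (S.expo (d + 1) (splitEquiv (S.rho_le d) (Sum.inl j)) : ℤ) - l)
      (firstCols (S.rho_le d) N)
      (firstCols (S.rho_le d) (lin a ^ l • R * S.stepProd a (d + 1))) := by
  refine ⟨S.isStructuralIndices hreg hcoef hd, ?_, exists_firstCols_left_inverse hNu _,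
    fun i j => S.isRegularAt_mul_stepProd hreg hcoef (d + 1) i _, ?_⟩
  · have hl0 : lin a ^ l ≠ 0 := pow_ne_zero _ (lin_ne_zero a)
    have h1 : R * toRat (firstCols (S.rho_le d) N) = firstCols (S.rho_le d) (R * toRat N) := rfl
    rw [h1]
    ext1 i j
    apply mul_left_cancel₀ hl0
    have h2 := S.mul_transform (a := a) (P := lin a ^ l • R) (d + 1)
    rw [← hN, toRat_lamProd, Matrix.smul_mul] at h2
    have h3 := congrFun (congrFun h2 i) (splitEquiv (S.rho_le d) (Sum.inl j))
    rw [Matrix.smul_apply, smul_eq_mul, Matrix.mul_diagonal] at h3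
    rw [firstCols_apply, h3, Matrix.mul_diagonal, firstCols_apply, zpow_sub₀ (lin_ne_zero a),
      zpow_natCast, zpow_natCast, mul_left_comm, mul_div_cancel₀ _ hl0]
  · have h1 : evalAt (firstCols (S.rho_le d) (lin a ^ l • R * S.stepProd a (d + 1))) a =
        firstCols (S.rho_le d) (evalAt (lin a ^ l • R * S.stepProd a (d + 1)) a) := rfl
    rw [h1, S.firstCols_evalAt_mul_stepProd hreg hcoef]
    exact Matrix.exists_mul_eq_one_of_mulVec_injective (S.L0_injective d)

end ToeplitzRankSearch

lemma laurentCoeff_toRat {μ ν : Type*} (P : Matrix μ ν ℂ[X]) (a : ℂ) (k : ℕ) :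
    laurentCoeff (toRat P) a k = taylorCoeff P a k := by
  ext i j
  exact coeff_laurentExp_algebraMap a (P i j) k

/-- If `G diag((λ-a)^w)` is a polynomial matrix and `G` has no pole at `a`, then `G` is a
polynomial matrix. -/
lemma exists_toRat_eq_of_mul_diagonal {m n : ℕ} {a : ℂ} {G : Matrix (Fin m) (Fin n) (RatFunc ℂ)}
    (hG : IsRegularAt G a) (w : Fin n → ℕ) {P : Matrix (Fin m) (Fin n) ℂ[X]}
    (h : G * Matrix.diagonal (fun j => lin a ^ w j) = toRat P) : ∃ Q, toRat Q = G := by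
  have : ∀ i j, ∃ q, G i j = algebraMap ℂ[X] _ q := fun i j => by
    refine exists_algebraMap_eq_of_lin_pow_mul (hG i j) (l := w j) (p := P i j) ?_
    have := congrFun (congrFun h i) j
    rw [Matrix.mul_diagonal, mul_comm] at this
    exact this
  choose q hq using this
  exact ⟨Matrix.of q, by ext1 i j; exact (hq i j).symm⟩

end

theorem theorem3p2 {m n : ℕ} :
    -- the search can be carried out, and it computes the ranks of the block Toeplitz matrices
    (∀ A : ℕ → Matrix (Fin m) (Fin n) ℂ,
      Nonempty (ToeplitzRankSearch A) ∧
      ∀ (S : ToeplitzRankSearch A) (k : ℕ),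
        (blockToeplitz A k).rank = ∑ i ∈ Finset.range (k + 1), S.rho i) ∧
    -- polynomial matrices
    (∀ (P : Matrix (Fin m) (Fin n) ℂ[X]) (a : ℂ) (S : ToeplitzRankSearch (taylorCoeff P a)),
      ∃ d : ℕ, IsLeast {k | S.rho k = (toRat P).rank} d ∧
      ∃ (N : Matrix (Fin n) (Fin n) ℂ[X]) (Pd : Matrix (Fin m) (Fin n) ℂ[X]),
        toRat N = S.transform a (d + 1) ∧
        IsUnit N ∧
        (∀ k, taylorCoeff Pd a k = S.coef (d + 1) k) ∧
        -- the factorization with all of `Λ_0, …, Λ_d`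
        P * N = Pd * S.LamProd a (d + 1) ∧
        S.IsIndexDiag a (d + 1) (S.LamProd a (d + 1)) ∧
        firstCols (S.rho_le d) (Pd.map (Polynomial.eval a)) = S.L0 d ∧
        (Pd.map (Polynomial.eval a)).rank = (toRat P).rank ∧
        -- the factorization with `Λ_d` kept in the left factor
        P * N = (Pd * S.Lam a d) * S.LamProd a d ∧
        S.IsIndexDiag a d (S.LamProd a d) ∧
        (Pd * S.Lam a d).map (Polynomial.eval a) = joinCols (S.rho_le d) (S.L0 d) 0 ∧
        (joinCols (S.rho_le d) (S.L0 d) 0).rank = (toRat P).rank ∧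
        Module.finrank ℂ (LinearMap.ker (joinCols (S.rho_le d) (S.L0 d) 0).mulVecLin) =
          n - (toRat P).rank ∧
        -- discarding the last columns
        ∃ σ : Fin (S.rho d) → ℕ,
          (∀ i ≤ d, ∀ j : Fin (S.rho d), S.rk i ≤ j.val → j.val < S.rk i + S.e i → σ j = i) ∧
          IsCompactLocalSmith P a σ (firstCols (S.rho_le d) N) (firstCols (S.rho_le d) Pd)) ∧
    -- rational matrices, possibly with a pole of order at most `l` at `a`
    (∀ (R : Matrix (Fin m) (Fin n) (RatFunc ℂ)) (a : ℂ) (l : ℕ),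
      (∀ k : ℤ, k < -(l : ℤ) → laurentCoeff R a k = 0) →
      ∀ S : ToeplitzRankSearch (fun k : ℕ => laurentCoeff R a ((k : ℤ) - (l : ℤ))),
      ∃ d : ℕ, IsLeast {k | S.rho k = R.rank} d ∧
      ∃ (N : Matrix (Fin n) (Fin n) ℂ[X]) (Rd : Matrix (Fin m) (Fin n) (RatFunc ℂ)),
        toRat N = S.transform a (d + 1) ∧
        IsUnit N ∧
        IsRegularAt Rd a ∧
        (∀ k : ℕ, laurentCoeff Rd a (k : ℤ) = S.coef (d + 1) k) ∧
        lin a ^ l • (R * toRat N) = Rd * toRat (S.LamProd a (d + 1)) ∧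
        S.IsIndexDiag a (d + 1) (S.LamProd a (d + 1)) ∧
        firstCols (S.rho_le d) (evalAt Rd a) = S.L0 d ∧
        (evalAt Rd a).rank = R.rank ∧
        lin a ^ l • (R * toRat N) = (Rd * toRat (S.Lam a d)) * toRat (S.LamProd a d) ∧
        S.IsIndexDiag a d (S.LamProd a d) ∧
        evalAt (Rd * toRat (S.Lam a d)) a = joinCols (S.rho_le d) (S.L0 d) 0 ∧
        (joinCols (S.rho_le d) (S.L0 d) 0).rank = R.rank ∧
        Module.finrank ℂ (LinearMap.ker (joinCols (S.rho_le d) (S.L0 d) 0).mulVecLin) =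
          n - R.rank ∧
        ∃ σ : Fin (S.rho d) → ℤ,
          (∀ i ≤ d, ∀ j : Fin (S.rho d), S.rk i ≤ j.val → j.val < S.rk i + S.e i →
            σ j = (i : ℤ) - (l : ℤ)) ∧
          IsCompactLocalSmithMcMillan R a σ
            (firstCols (S.rho_le d) N) (firstCols (S.rho_le d) Rd)) := by
  refine ⟨fun A => ⟨ToeplitzRankSearch.nonempty A, fun S k => S.rank_blockToeplitz k⟩,
    fun P a S => ?_, fun R a l hneg S => ?_⟩
  · have hreg : IsRegularAt (toRat P) a := isRegularAt_toRat P
    have hcoef : ∀ k : ℕ, laurentCoeff (toRat P) a k = taylorCoeff P a k :=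
      laurentCoeff_toRat P a
    -- The polynomial case is the rational one with l = 0, apart from showing that P^{(d)} is
    -- polynomial.
    have hP : lin a ^ 0 • toRat P = toRat P := by rw [pow_zero, one_smul]
    obtain ⟨d, hd⟩ := S.exists_isLeast_rank hreg hcoef
    have hrank : S.rho d = (toRat P).rank := hd.1
    obtain ⟨N, hN, hNu⟩ := S.exists_polynomial_transform a (d + 1)
    have hPN : toRat (P * N) =
        toRat P * S.stepProd a (d + 1) * toRat (S.LamProd a (d + 1)) := by
      rw [toRat_mul, hN, S.mul_transform]
    -- Since P N is polynomial, P^{(d)} could only have a pole at a, and it has none there.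
    obtain ⟨Pd, hPd⟩ := exists_toRat_eq_of_mul_diagonal
      (S.isRegularAt_mul_stepProd hreg hcoef (d + 1)) (S.expo (d + 1)) (P := P * N)
      (by rw [hPN, S.toRat_lamProd])
    have hfac : P * N = Pd * S.LamProd a (d + 1) := by
      apply toRat_injective
      rw [hPN, toRat_mul, hPd]
    have hsmith := S.isCompactLocalSmithMcMillan (l := 0) (by rwa [hP]) (by rwa [hP]) hrank hN hNu
    have hσ : (fun j : Fin (S.rho d) =>
        (S.expo (d + 1) (splitEquiv (S.rho_le d) (Sum.inl j)) : ℤ) - (0 : ℕ)) =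
        fun j => (S.expo (d + 1) (splitEquiv (S.rho_le d) (Sum.inl j)) : ℤ) := by
      simp
    rw [hP, hσ] at hsmith
    have hL0 : firstCols (S.rho_le d) (Pd.map (Polynomial.eval a)) = S.L0 d := by
      rw [← evalAt_toRat, hPd, S.firstCols_evalAt_mul_stepProd hreg hcoef]
    refine ⟨d, hd, N, Pd, hN, hNu, fun k => ?_, hfac, S.isIndexDiag a _, hL0, ?_, ?_,
      S.isIndexDiag a _, ?_, ?_, ?_, fun j => S.expo (d + 1) (splitEquiv (S.rho_le d) (Sum.inl j)),
      fun i hi j h1 h2 => S.expo_inl_of_block hi h1 h2, hsmith.structuralIndices, ?_,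
      hsmith.polynomial_left_inverse, ?_⟩
    · rw [← laurentCoeff_toRat, hPd, (S.coeff_stepProd a hreg hcoef (d + 1)).2]
    · rw [← evalAt_toRat, hPd, S.rank_evalAt_mul_stepProd hreg hcoef hrank]
    · rw [hfac, S.lamProd_succ, S.lamProd_comm, Matrix.mul_assoc]
    · rw [← evalAt_toRat, toRat_mul, hPd, S.evalAt_mul_stepProd_mul_lam hreg hcoef]
    · rw [S.rank_joinCols_L0, hrank]
    · rw [S.finrank_ker_joinCols_L0, hrank]
    · rw [mul_firstCols, hfac, S.lamProd_eq, firstCols_mul_diagonal]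
    · have : (firstCols (S.rho_le d) Pd).map (Polynomial.eval a) =
          firstCols (S.rho_le d) (Pd.map (Polynomial.eval a)) := rfl
      rw [this, hL0]
      exact Matrix.exists_mul_eq_one_of_mulVec_injective (S.L0_injective d)
  · have hcoeff : ∀ i j (k : ℤ), (laurentExp a ((lin a ^ l • R) i j)).coeff k =
        laurentCoeff R a (k - l) i j := fun i j k =>
      coeff_laurentExp_lin_pow_mul a l (R i j) k
    have hreg : IsRegularAt (lin a ^ l • R) a := fun i j =>
      mem_regularSubring_of_coeff fun k hk => by
        rw [hcoeff, hneg _ (by omega)]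
        rfl
    have hcoef : ∀ k : ℕ, laurentCoeff (lin a ^ l • R) a k = laurentCoeff R a ((k : ℤ) - l) :=
      fun k => by ext i j; exact hcoeff i j k
    have hPR : (lin a ^ l • R).rank = R.rank :=
      Matrix.rank_smul_of_mem_nonZeroDivisors _
        (mem_nonZeroDivisors_of_ne_zero (pow_ne_zero _ (lin_ne_zero a)))
    obtain ⟨d, hd⟩ := S.exists_isLeast_rank hreg hcoef
    have hrank : S.rho d = (lin a ^ l • R).rank := hd.1
    have hrank' : S.rho d = R.rank := hrank.trans hPR
    obtain ⟨N, hN, hNu⟩ := S.exists_polynomial_transform a (d + 1)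
    have hfac : lin a ^ l • (R * toRat N) =
        lin a ^ l • R * S.stepProd a (d + 1) * toRat (S.LamProd a (d + 1)) := by
      rw [← Matrix.smul_mul, hN, S.mul_transform]
    rw [hPR] at hd
    refine ⟨d, hd, N, lin a ^ l • R * S.stepProd a (d + 1), hN, hNu,
      S.isRegularAt_mul_stepProd hreg hcoef _, (S.coeff_stepProd a hreg hcoef (d + 1)).2, hfac,
      S.isIndexDiag a _, S.firstCols_evalAt_mul_stepProd hreg hcoef d, ?_, ?_,
      S.isIndexDiag a _, S.evalAt_mul_stepProd_mul_lam hreg hcoef d, ?_, ?_, _,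
      fun i hi j h1 h2 => ?_, S.isCompactLocalSmithMcMillan hreg hcoef hrank' hN hNu⟩
    · rw [S.rank_evalAt_mul_stepProd hreg hcoef hrank, hPR]
    · rw [hfac, S.lamProd_succ, S.lamProd_comm, toRat_mul, ← Matrix.mul_assoc]
    · rw [S.rank_joinCols_L0, hrank']
    · rw [S.finrank_ker_joinCols_L0, hrank']
    · rw [S.expo_inl_of_block hi h1 h2]
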